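/- Let $1\le N\le 4$. Consider the following two-component setting. $\Omega\subseteq\mathbb R^N$ is a domain, $a_{12}=a_{21}>0$, $\beta_n>0$ with $\beta_n\to+\infty$; $f_{i,\beta_n},f_i\in C^1(\Omega\times\mathbb R)$ ($i=1,2$) satisfy $|f_{i,\beta_n}(x,s)|\le Cs$ for $x\in\Omega$, $s\in[0,1]$ with $C$ independent of $n$, and $f_{i,\beta_n}\to f_i$ in $C_{\rm loc}(\Omega\times\mathbb R)$; $(u_{1,\beta_n},u_{2,\beta_n})$ are positive weak solutions, represented by $C^1$ functions, of $$-\Delta u_{i,\beta}=f_{i,\beta}(x,u_{i,\beta})-\beta\,u_{i,\beta}\,a_{ij}\,u_{j,\beta}^2\quad\text{in }\Omega,\qquad \{i,j\}=\{1,2\},$$ uniformly bounded in $L^\infty(\Omega)$, which converge in $C^{0,\alpha}_{\rm loc}(\Omega)$ (for every $0<\alpha<1$) and in $H^1_{\rm loc}(\Omega)$ to a locally Lipschitz limit $u=(u_1,u_2)$. Put $\Gamma_{\beta}=\{x\in\Omega: u_{1,\beta}(x)=u_{2,\beta}(x)\}$, $\Gamma=\{x\in\Omega: u_1(x)=u_2(x)=0\}$,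 and let $\mathcal R$ be the set of $x_0\in\Gamma$ with $$\lim_{r\to0^+}\frac{r\int_{B_r(x_0)}\sum_{i}\left(|\nabla u_i|^2-f_i(x,u_i)u_i\right)dx}{\int_{\partial B_r(x_0)}\sum_i u_i^2\,d\sigma}=1 .$$ (i) In general, for $x_{\beta_n}\in\Gamma_{\beta_n}$ with $x_{\beta_n}\to x_0\in\mathcal R$, the gradients $\nabla(u_{1,\beta_n}-u_{2,\beta_n})(x_{\beta_n})$ do not converge to $\nabla(u_1-u_2)(x_0)$. Precisely, in every dimension $1\le N\le 4$ there are data as above and points $x_{\beta_n}\in\Gamma_{\beta_n}$, $x_{\beta_n}\to x_0\in\mathcal R$, such that $u_1-u_2$ is differentiable at $x_0$, the limit of $\nabla(u_{1,\beta_n}-u_{2,\beta_n})(x_{\beta_n})$ exists, and $$\lim_{n\to\infty}\nabla(u_{1,\beta_n}-u_{2,\beta_n})(x_{\beta_n})\ne\nabla(u_1-u_2)(x_0),$$ and such that $\{u_{1,\beta_n}-u_{2,\beta_n}\}_n$ is not bounded in $C^{1,\alpha}(B_\rho(x_0))$ for any $\alpha\in(0,1)$ and any $\rho>0$ with $B_\rho(x_0)\subseteq\Omega$.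 (ii) More generally, for all data as above and all $x_{\beta_n}\in\Gamma_{\beta_n}$ with $x_{\beta_n}\to x_0\in\mathcal R$: if $\nabla(u_{1,\beta_n}-u_{2,\beta_n})(x_{\beta_n})$ does not converge to $\nabla(u_1-u_2)(x_0)$, then $\{u_{1,\beta_n}-u_{2,\beta_n}\}_n$ is not bounded in $C^{1,\alpha}(B_\rho(x_0))$ for any $\alpha\in(0,1)$ and any $\rho>0$ with $B_\rho(x_0)\subseteq\Omega$. -/

import Mathlib

open Set Filter Topology MeasureTheory
open scoped ContDiff

noncomputable section

namespace Competition

/-- The space `ℝ^N` with its Euclidean norm. -/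
abbrev E (N : ℕ) := EuclideanSpace ℝ (Fin N)

/-- The competition system with parameter `β`: `v = (v₁, …, v_k)` is a positive weak solution of
`-Δ vᵢ = gᵢ(x, vᵢ) - β vᵢ ∑_{j ≠ i} aᵢⱼ vⱼ²` in `Ω`. For `gᵢ` of class `C¹`, bounded weak solutions
have a continuously differentiable representative by elliptic regularity; `v` is that
representative, so that pointwise values and pointwise gradients make sense. -/
structure IsPositiveWeakSolution {N k : ℕ} (Ω : Set (E N)) (a : Fin k → Fin k → ℝ) (β : ℝ)
    (g : Fin k → E N → ℝ → ℝ) (v : Fin k → E N → ℝ) : Prop where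
  contDiffOn : ∀ i, ContDiffOn ℝ 1 (v i) Ω
  pos : ∀ i, ∀ x ∈ Ω, 0 < v i x
  weak_eq : ∀ i, ∀ φ : E N → ℝ, ContDiff ℝ ∞ φ → HasCompactSupport φ → tsupport φ ⊆ Ω →
    ∫ x in Ω, inner ℝ (gradient (v i) x) (gradient φ x) =
      ∫ x in Ω, (g i x (v i x) - β * v i x * ∑ j ∈ Finset.univ.erase i, a i j * v j x ^ 2) * φ x

/-- `w n → w₀` in `C^{0,α}_loc(Ω)`: on every compact subset of `Ω` both the supremum norm and the
`α`-Hölder seminorm of `w n - w₀` tend to zero. -/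
def TendstoHolderLoc {N : ℕ} (Ω : Set (E N)) (α : ℝ) (w : ℕ → E N → ℝ) (w₀ : E N → ℝ) : Prop :=
  ∀ K : Set (E N), IsCompact K → K ⊆ Ω → ∀ ε > 0, ∀ᶠ n in atTop,
    (∀ x ∈ K, |w n x - w₀ x| ≤ ε) ∧
    ∀ x ∈ K, ∀ y ∈ K, |(w n x - w₀ x) - (w n y - w₀ y)| ≤ ε * ‖x - y‖ ^ α

/-- `w n → w₀` in `H¹_loc(Ω)`. It is used for functions `w n` of class `C¹` and `w₀` locally
Lipschitz, whose weak gradients are their almost everywhere defined classical gradients. -/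
def TendstoH1Loc {N : ℕ} (Ω : Set (E N)) (w : ℕ → E N → ℝ) (w₀ : E N → ℝ) : Prop :=
  ∀ K : Set (E N), IsCompact K → K ⊆ Ω →
    Tendsto (fun n => eLpNorm (fun x => w n x - w₀ x) 2 (volume.restrict K)) atTop (𝓝 0) ∧
    Tendsto (fun n => eLpNorm (fun x => gradient (w n) x - gradient w₀ x) 2 (volume.restrict K))
      atTop (𝓝 0)

/-- The setting: a sequence `β n → +∞`, nonlinearities `fβ n` converging to `f`, and positive
solutions `uβ n` of the corresponding systems on the domain `Ω ⊆ ℝ^N`, bounded in `L^∞(Ω)` and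
converging to the limit profile `u`. -/
structure IsSegregatingSequence {N k : ℕ} (Ω : Set (E N)) (a : Fin k → Fin k → ℝ) (β : ℕ → ℝ)
    (fβ : ℕ → Fin k → E N → ℝ → ℝ) (f : Fin k → E N → ℝ → ℝ)
    (uβ : ℕ → Fin k → E N → ℝ) (u : Fin k → E N → ℝ) : Prop where
  isOpen : IsOpen Ω
  isConnected : IsConnected Ω
  symm : ∀ i j, a i j = a j i
  coupling_pos : ∀ i j, i ≠ j → 0 < a i j
  beta_pos : ∀ n, 0 < β n
  beta_tendsto : Tendsto β atTop atTop
  /-- regularity of the nonlinearities -/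
  contDiffOn_approx : ∀ n i, ContDiffOn ℝ 1 (fun p : E N × ℝ => fβ n i p.1 p.2) (Ω ×ˢ univ)
  contDiffOn_limit : ∀ i, ContDiffOn ℝ 1 (fun p : E N × ℝ => f i p.1 p.2) (Ω ×ˢ univ)
  /-- `fβ n i x s = O(s)` as `s → 0`, uniformly -/
  linear_bound : ∃ C : ℝ, ∀ n i, ∀ x ∈ Ω, ∀ s ∈ Icc (0 : ℝ) 1, |fβ n i x s| ≤ C * s
  /-- convergence of the nonlinearities in `C_loc(Ω × ℝ)` -/
  nonlinearity_tendsto : ∀ i, TendstoLocallyUniformlyOn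
    (fun n (p : E N × ℝ) => fβ n i p.1 p.2) (fun p => f i p.1 p.2) atTop (Ω ×ˢ univ)
  solution : ∀ n, IsPositiveWeakSolution Ω a (β n) (fβ n) (uβ n)
  /-- uniform bound in `L^∞(Ω)` -/
  bounded : ∃ C : ℝ, ∀ n i, ∀ x ∈ Ω, |uβ n i x| ≤ C
  /-- the limit profile -/
  limit_lipschitz : ∀ i, LocallyLipschitzOn Ω (u i)
  tendsto_holder : ∀ i, ∀ α ∈ Ioo (0 : ℝ) 1, TendstoHolderLoc Ω α (fun n => uβ n i) (u i)
  tendsto_h1 : ∀ i, TendstoH1Loc Ω (fun n => uβ n i) (u i)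

/-- The interface of `v`: the points where two components coincide and dominate all others. -/
def interface {N k : ℕ} (Ω : Set (E N)) (v : Fin k → E N → ℝ) : Set (E N) :=
  {x ∈ Ω | ∃ i j, i ≠ j ∧ v i x = v j x ∧ ∀ l, v l x ≤ v i x}

/-- The free boundary (nodal set) of the limit profile. -/
def freeBoundary {N k : ℕ} (Ω : Set (E N)) (u : Fin k → E N → ℝ) : Set (E N) :=
  {x ∈ Ω | ∀ i, u i x = 0}

/-- `∫_{∂B_r(x₀)} h dσ`, the surface integral over the sphere of radius `r` and centre `x₀`, written
on the unit sphere with its surface measure `volume.toSphere` (for `N = 1` the counting measure of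
the two points). -/
def sphereIntegral {N : ℕ} (h : E N → ℝ) (x₀ : E N) (r : ℝ) : ℝ :=
  r ^ (N - 1) *
    ∫ θ : Metric.sphere (0 : E N) 1, h (x₀ + r • (θ : E N)) ∂((volume : Measure (E N)).toSphere)

/-- The Almgren frequency function
`r ∫_{B_r(x₀)} ∑ᵢ (|∇uᵢ|² - fᵢ(x,uᵢ) uᵢ) / ∫_{∂B_r(x₀)} ∑ᵢ uᵢ²`. The `uᵢ` are locally Lipschitz, and
`gradient` is their almost everywhere defined gradient. -/
def almgren {N k : ℕ} (f : Fin k → E N → ℝ → ℝ) (u : Fin k → E N → ℝ) (x₀ : E N) (r : ℝ) : ℝ :=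
  (r * ∫ x in Metric.ball x₀ r, ∑ i, (‖gradient (u i) x‖ ^ 2 - f i x (u i x) * u i x)) /
    sphereIntegral (fun x => ∑ i, u i x ^ 2) x₀ r

/-- The regular part of the free boundary: the points where `N(u, x, 0⁺) = 1`. -/
def regularPart {N k : ℕ} (Ω : Set (E N)) (f : Fin k → E N → ℝ → ℝ) (u : Fin k → E N → ℝ) :
    Set (E N) :=
  {x ∈ freeBoundary Ω u | Tendsto (almgren f u x) (𝓝[>] 0) (𝓝 1)}

/-- The sequence `w` of differentiable functions is bounded in `C^{1,α}(S)`. -/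
def BoundedC1Holder {N : ℕ} (S : Set (E N)) (α : ℝ) (w : ℕ → E N → ℝ) : Prop :=
  ∃ C : ℝ, ∀ n, (∀ x ∈ S, |w n x| ≤ C) ∧ (∀ x ∈ S, ‖gradient (w n) x‖ ≤ C) ∧
    ∀ x ∈ S, ∀ y ∈ S, ‖gradient (w n) x - gradient (w n) y‖ ≤ C * ‖x - y‖ ^ α

end Competition

end

/-! The counterexample is one-dimensional. On `[0, T]` consider `U'' = U V²`, `V'' = U² V` with
`U(0) = V(0) = h`, `U'(0) = 1 = -V'(0)`, and choose `h` by shooting so that `V(T) = 0`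
(`exists_isHalfProfile`). Reflection gives a positive profile on `(-T, T)` with `V(t) = U(-t)`. The
energy `U'² + V'² - U² V²` is conserved and the coupling term vanishes at `T`, so the final slope
satisfies `U'(T)² ≤ 2` (`IsHalfProfile.P_end_sq_le`), whereas `(U - V)'(0) = 2`.

With `m = T → ∞`, the functions `U(± m x_k) / m` solve the system in the slab `|x_k| < 1` with `β =
m⁴`. Bounds uniform in `T` (`IsHalfProfile.P_end_sub_mul_sq_le`, `IsHalfProfile.neg_Q_mul_le`,
`IsHalfProfile.le_U_sub`) show that they converge to `(a x_k⁺, a x_k⁻)`, where `a ≤ 3/2` is a limit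
of the final slopes. The origin is an interface point of every pair and a regular point of the limit
(`almgren_ramp`). There the gradients of the differences are constantly `2 e_k`, and the gradient of
the limit is `a e_k`.

The unboundedness in `C^{1,α}` is a compactness statement, valid for all data: a bound would let the
first order Taylor estimate pass to the limit, so that every cluster point of the gradients would be
the gradient of the limit (`tendsto_gradient_of_holder`). -/

/-! ### Flows, monotonicity from one-sided derivatives, truncation. -/

/-- A bounded Lipschitz vector field has a flow on every compact time interval `[0, T]`, continuous
in the initial point. -/
theorem exists_flow_of_lipschitz_of_bounded {X : Type*} [NormedAddCommGroup X] [NormedSpace ℝ X]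
    [CompleteSpace X] {F : X → X} {K : NNReal} (hF : LipschitzWith K F) {B : NNReal}
    (hB : ∀ x, ‖F x‖ ≤ B) {T : ℝ} (hT : 0 ≤ T) (R : NNReal) :
    ∃ γ : X → ℝ → X, (∀ x ∈ Metric.closedBall (0 : X) R, γ x 0 = x ∧
      ∀ t ∈ Icc 0 T, HasDerivWithinAt (γ x) (F (γ x t)) (Icc 0 T) t) ∧
      ContinuousOn (fun x => γ x T) (Metric.closedBall (0 : X) R) := by
  have hPL : IsPicardLindelof (fun _ : ℝ => F) (⟨0, left_mem_Icc.2 hT⟩ : Icc (0 : ℝ) T) (0 : X)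
      (B * T.toNNReal + R) R B K := by
    apply IsPicardLindelof.of_time_independent
    · exact fun x _ => hB x
    · exact hF.lipschitzOnWith
    · simp [hT]
  obtain ⟨γ, h1, L', h2⟩ :=
    hPL.exists_forall_mem_closedBall_eq_hasDerivWithinAt_lipschitzOnWith
  exact ⟨γ, h1, (h2 T (right_mem_Icc.2 hT)).continuousOn⟩

theorem monotoneOn_Icc_of_hasDerivWithinAt {f f' : ℝ → ℝ} {a b : ℝ}
    (hf : ∀ t ∈ Icc a b, HasDerivWithinAt f (f' t) (Icc a b) t) (h : ∀ t ∈ Icc a b, 0 ≤ f' t) :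
    MonotoneOn f (Icc a b) := by
  refine monotoneOn_of_hasDerivWithinAt_nonneg (convex_Icc a b)
    (fun t ht => (hf t ht).continuousWithinAt) (f' := f') ?_ ?_
  · intro t ht
    exact (hf t (interior_subset ht)).mono interior_subset
  · intro t ht
    exact h t (interior_subset ht)

theorem antitoneOn_Icc_of_hasDerivWithinAt {f f' : ℝ → ℝ} {a b : ℝ}
    (hf : ∀ t ∈ Icc a b, HasDerivWithinAt f (f' t) (Icc a b) t) (h : ∀ t ∈ Icc a b, f' t ≤ 0) :
    AntitoneOn f (Icc a b) := by
  have := monotoneOn_Icc_of_hasDerivWithinAt (f := fun t => -f t) (f' := fun t => -f' t)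
    (fun t ht => (hf t ht).neg) (fun t ht => by linarith [h t ht])
  intro x hx y hy hxy
  have := this hx hy hxy
  linarith

/-- Restriction of a real number to the interval `[a, b]`. -/
def clip (a b x : ℝ) : ℝ := max a (min b x)

theorem le_clip (a b x : ℝ) : a ≤ clip a b x := le_max_left _ _

theorem clip_le {a b : ℝ} (h : a ≤ b) (x : ℝ) : clip a b x ≤ b :=
  max_le h (min_le_left _ _)

theorem clip_eq_self {a b x : ℝ} (h1 : a ≤ x) (h2 : x ≤ b) : clip a b x = x := by
  rw [clip, min_eq_right h2, max_eq_right h1]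

theorem clip_eq_right {a b x : ℝ} (h : a ≤ b) (h1 : b ≤ x) : clip a b x = b := by
  rw [clip, min_eq_left h1, max_eq_right h]

theorem lipschitzWith_clip (a b : ℝ) : LipschitzWith 1 (clip a b) :=
  (LipschitzWith.id.const_min b).const_max a

/-! ### The shooting problem for the coupled system. -/

/-- The first order form of the system `U'' = U V²`, `V'' = U² V` in the variables
`(U, V, U', V')`. -/
def coupledField (x : ℝ × ℝ × ℝ × ℝ) : ℝ × ℝ × ℝ × ℝ :=
  (x.2.2.1, x.2.2.2, x.1 * x.2.1 ^ 2, x.1 ^ 2 * x.2.1)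

/-- Restriction of the phase space of `coupledField` to a box. -/
def clipBox (M : ℝ) (x : ℝ × ℝ × ℝ × ℝ) : ℝ × ℝ × ℝ × ℝ :=
  (clip 0 M x.1, clip 0 2 x.2.1, clip 0 M x.2.2.1, clip (-1) 0 x.2.2.2)

theorem lipschitzWith_clipBox (M : ℝ) : LipschitzWith 1 (clipBox M) := by
  have p2 : LipschitzWith 1 (fun x : ℝ × ℝ × ℝ × ℝ => x.2) := LipschitzWith.prod_snd
  have p3 : LipschitzWith 1 (fun x : ℝ × ℝ × ℝ × ℝ => x.2.2) := by
    simpa using! LipschitzWith.prod_snd.comp p2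
  have h1 := (lipschitzWith_clip 0 M).comp (LipschitzWith.prod_fst (α := ℝ) (β := ℝ × ℝ × ℝ))
  have h2 := (lipschitzWith_clip 0 2).comp (LipschitzWith.prod_fst.comp p2)
  have h3 := (lipschitzWith_clip 0 M).comp (LipschitzWith.prod_fst.comp p3)
  have h4 := (lipschitzWith_clip (-1) 0).comp (LipschitzWith.prod_snd.comp p3)
  have := h1.prodMk (h2.prodMk (h3.prodMk h4))
  simpa [Function.comp_def] using! this

/-- The polynomial field is only locally Lipschitz, so solutions could blow up before time `T`.
After truncation its argument stays in a compact convex box, where a `C¹` field is Lipschitz and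
bounded. -/
theorem exists_lipschitzWith_clipped {M : ℝ} (hM : 0 ≤ M) :
    ∃ K B : NNReal, LipschitzWith K (fun x => coupledField (clipBox M x)) ∧
      ∀ x, ‖coupledField (clipBox M x)‖ ≤ B := by
  have hcont : ContDiff ℝ 1 coupledField := by unfold coupledField; fun_prop
  set S : Set (ℝ × ℝ × ℝ × ℝ) := Icc (0, 0, 0, -1) (M, 2, M, 0)
  have hmaps : ∀ x, clipBox M x ∈ S := by
    intro x
    refine ⟨⟨le_clip _ _ _, le_clip _ _ _, le_clip _ _ _, le_clip _ _ _⟩,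
      ⟨clip_le hM _, clip_le (by norm_num) _, clip_le hM _, clip_le (by norm_num) _⟩⟩
  obtain ⟨K, hK⟩ := hcont.contDiffOn.exists_lipschitzOnWith one_ne_zero
    (convex_Icc (0, 0, 0, -1) (M, 2, M, 0)) isCompact_Icc
  obtain ⟨B, hB⟩ := (isCompact_Icc (a := ((0, 0, 0, -1) : ℝ × ℝ × ℝ × ℝ))
    (b := (M, 2, M, 0))).exists_bound_of_continuousOn hcont.continuous.continuousOn
  refine ⟨K, B.toNNReal, ?_, fun x => (hB _ (hmaps x)).trans (Real.le_coe_toNNReal B)⟩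
  have := hK.comp (lipschitzWith_clipBox M).lipschitzOnWith (s := univ) (fun x _ => hmaps x)
  simpa [Function.comp_def] using! this

/-- Solutions of the system `U'' = U V²`, `V'' = U² V` on `[0, T]` with `U(0) = V(0) = h`,
`U'(0) = 1 = -V'(0)`, and `V(T) = 0`; `P = U'` and `Q = V'`. -/
structure IsHalfProfile (T h : ℝ) (U V P Q : ℝ → ℝ) : Prop where
  h_nonneg : 0 ≤ h
  h_le : h ≤ 2
  U_zero : U 0 = h
  V_zero : V 0 = h
  P_zero : P 0 = 1
  Q_zero : Q 0 = -1
  V_end : V T = 0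
  hU : ∀ t ∈ Icc 0 T, HasDerivWithinAt U (P t) (Icc 0 T) t
  hV : ∀ t ∈ Icc 0 T, HasDerivWithinAt V (Q t) (Icc 0 T) t
  hP : ∀ t ∈ Icc 0 T, HasDerivWithinAt P (U t * V t ^ 2) (Icc 0 T) t
  hQ : ∀ t ∈ Icc 0 T, HasDerivWithinAt Q (U t ^ 2 * V t) (Icc 0 T) t
  U_nonneg : ∀ t ∈ Icc 0 T, 0 ≤ U t
  V_nonneg : ∀ t ∈ Icc 0 T, 0 ≤ V t
  Q_nonpos : ∀ t ∈ Icc 0 T, Q t ≤ 0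

/-- The four components of a trajectory of the clipped system. -/
structure IsClippedTrajectory (M T h : ℝ) (U V P Q : ℝ → ℝ) : Prop where
  U_zero : U 0 = h
  V_zero : V 0 = h
  P_zero : P 0 = 1
  Q_zero : Q 0 = -1
  hU : ∀ t ∈ Icc 0 T, HasDerivWithinAt U (clip 0 M (P t)) (Icc 0 T) t
  hV : ∀ t ∈ Icc 0 T, HasDerivWithinAt V (clip (-1) 0 (Q t)) (Icc 0 T) t
  hP : ∀ t ∈ Icc 0 T, HasDerivWithinAt P (clip 0 M (U t) * clip 0 2 (V t) ^ 2) (Icc 0 T) t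
  hQ : ∀ t ∈ Icc 0 T, HasDerivWithinAt Q (clip 0 M (U t) ^ 2 * clip 0 2 (V t)) (Icc 0 T) t

namespace IsClippedTrajectory

variable {M T h : ℝ} {U V P Q : ℝ → ℝ}

theorem U_mono (H : IsClippedTrajectory M T h U V P Q) : MonotoneOn U (Icc 0 T) :=
  monotoneOn_Icc_of_hasDerivWithinAt H.hU fun _ _ => le_clip _ _ _

theorem Q_mono (H : IsClippedTrajectory M T h U V P Q) : MonotoneOn Q (Icc 0 T) :=
  monotoneOn_Icc_of_hasDerivWithinAt H.hQ fun _ _ => mul_nonneg (sq_nonneg _) (le_clip _ _ _)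

theorem P_mono (H : IsClippedTrajectory M T h U V P Q) : MonotoneOn P (Icc 0 T) :=
  monotoneOn_Icc_of_hasDerivWithinAt H.hP fun _ _ => mul_nonneg (le_clip _ _ _) (sq_nonneg _)

theorem V_anti (H : IsClippedTrajectory M T h U V P Q) : AntitoneOn V (Icc 0 T) :=
  antitoneOn_Icc_of_hasDerivWithinAt H.hV fun _ _ => clip_le (by norm_num) _

/-- The upper end of the shooting interval. Up to time `1` the truncated slope keeps `V ≥ 1`, and `U
≥ 2`, so `Q` climbs from `-1` to at least `0`. From then on the truncated slope of `V` is zero and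
`V` no longer decreases. -/
theorem V_end_pos (H : IsClippedTrajectory M T 2 U V P Q) (hM : 2 ≤ M) (hT : 1 ≤ T) :
    0 < V T := by
  have h0 : (0 : ℝ) ∈ Icc 0 T := ⟨le_rfl, by linarith⟩
  have h1 : (1 : ℝ) ∈ Icc 0 T := ⟨by norm_num, hT⟩
  have hsub : Icc (0 : ℝ) 1 ⊆ Icc 0 T := Icc_subset_Icc_right hT
  have hVlow : ∀ t ∈ Icc (0 : ℝ) 1, 1 ≤ V t := by
    intro t ht
    have := monotoneOn_Icc_of_hasDerivWithinAt (f := fun t => V t + t)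
      (f' := fun t => clip (-1) 0 (Q t) + 1)
      (fun t ht => (H.hV t ht).add (hasDerivWithinAt_id _ _))
      (fun t _ => by linarith [le_clip (-1) 0 (Q t)]) h0 (hsub ht) ht.1
    simp only [H.V_zero] at this
    linarith [ht.2]
  have hQ1 : 0 ≤ Q 1 := by
    have := monotoneOn_Icc_of_hasDerivWithinAt (f := fun t => Q t - t) (a := 0) (b := 1)
      (f' := fun t => clip 0 M (U t) ^ 2 * clip 0 2 (V t) - 1)
      (fun t ht => ((H.hQ t (hsub ht)).mono hsub).sub (hasDerivWithinAt_id _ _))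
      (fun t ht => by
        have a1 : 2 ≤ U t := by
          have := H.U_mono h0 (hsub ht) ht.1
          rwa [H.U_zero] at this
        have a2 : 2 ≤ clip 0 M (U t) := le_max_of_le_right (le_min hM a1)
        have a3 : 1 ≤ clip 0 2 (V t) := le_max_of_le_right (le_min (by norm_num) (hVlow t ht))
        nlinarith) (left_mem_Icc.2 zero_le_one) (right_mem_Icc.2 zero_le_one) zero_le_one
    simp only [H.Q_zero] at this
    linarith
  have hsub' : Icc (1 : ℝ) T ⊆ Icc 0 T := Icc_subset_Icc_left zero_le_one
  have := monotoneOn_Icc_of_hasDerivWithinAt (f := V) (a := 1) (b := T)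
    (fun t ht => (H.hV t (hsub' ht)).mono hsub')
    (fun t ht => by
      have := H.Q_mono h1 (hsub' ht) ht.1
      rw [clip_eq_right (by norm_num) (hQ1.trans this)]) (left_mem_Icc.2 hT) (right_mem_Icc.2 hT) hT
  linarith [hVlow 1 (right_mem_Icc.2 zero_le_one)]

/-- If `Q` became positive it would vanish at some `s`. After `s` the truncated `V` is constant,
hence equal to `V T = 0`, which makes `Q` constant too and leaves it at `0`. -/
theorem Q_nonpos (H : IsClippedTrajectory M T h U V P Q) (hT : 0 ≤ T) (hV : V T = 0) :
    ∀ t ∈ Icc 0 T, Q t ≤ 0 := by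
  have hend : Q T ≤ 0 := by
    by_contra! hpos
    have hc : ContinuousOn Q (Icc 0 T) := fun t ht => (H.hQ t ht).continuousWithinAt
    obtain ⟨s, hs, hs0⟩ := intermediate_value_Icc hT hc
      (show (0 : ℝ) ∈ Icc (Q 0) (Q T) from ⟨by rw [H.Q_zero]; norm_num, hpos.le⟩)
    have hsub : Icc s T ⊆ Icc 0 T := Icc_subset_Icc_left hs.1
    have hVz : ∀ t ∈ Icc s T, V t = 0 := by
      intro t ht
      have h1 := monotoneOn_Icc_of_hasDerivWithinAt (f := V) (a := s) (b := T)
        (fun t ht => (H.hV t (hsub ht)).mono hsub)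
        (fun t ht => by
          have := H.Q_mono hs (hsub ht) ht.1
          rw [clip_eq_right (by norm_num) (hs0 ▸ this)]) ht (right_mem_Icc.2 hs.2) ht.2
      have h2 := H.V_anti (hsub ht) (right_mem_Icc.2 hT) ht.2
      linarith
    have h1 := antitoneOn_Icc_of_hasDerivWithinAt (f := Q) (a := s) (b := T)
      (fun t ht => (H.hQ t (hsub ht)).mono hsub)
      (fun t ht => by
        rw [hVz t ht, clip_eq_self le_rfl (by norm_num)]; simp)
      (left_mem_Icc.2 hs.2) (right_mem_Icc.2 hs.2) hs.2
    linarith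
  intro t ht
  exact (H.Q_mono ht (right_mem_Icc.2 hT) ht.2).trans hend

/-- A priori bounds show that the trajectory never leaves the box, so the truncation is inactive and
the original system is solved. -/
theorem isHalfProfile (H : IsClippedTrajectory M T h U V P Q) (hT : 0 ≤ T) (hh : 0 ≤ h)
    (hh2 : h ≤ 2) (hM : 2 + (3 + 2 * T) * T ≤ M) (hM' : 3 + 2 * T ≤ M) (hV : V T = 0) :
    IsHalfProfile T h U V P Q := by
  have h0 : (0 : ℝ) ∈ Icc 0 T := left_mem_Icc.2 hT
  have hTT : T ∈ Icc 0 T := right_mem_Icc.2 hT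
  have hQn := H.Q_nonpos hT hV
  have hV0 : ∀ t ∈ Icc 0 T, 0 ≤ V t := fun t ht => hV ▸ H.V_anti ht hTT ht.2
  have hV2 : ∀ t ∈ Icc 0 T, V t ≤ 2 := fun t ht => by
    have := H.V_anti h0 ht ht.1
    rw [H.V_zero] at this
    linarith
  have hQ1 : ∀ t ∈ Icc 0 T, -1 ≤ Q t := fun t ht => H.Q_zero ▸ H.Q_mono h0 ht ht.1
  have hP1 : ∀ t ∈ Icc 0 T, 1 ≤ P t := fun t ht => H.P_zero ▸ H.P_mono h0 ht ht.1
  have hP2 : ∀ t ∈ Icc 0 T, P t ≤ 3 + 2 * T := by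
    intro t ht
    -- With `u ≥ 0` and `0 ≤ v ≤ 2`, adding `v (u - 1)² ≥ 0` and `u v (2 - v) ≥ 0` gives `u v² ≤ u²
    -- v + v ≤ u² v + 2`. Thus `P` grows at most like `Q + 2t`, and `Q ≤ 0`.
    have := monotoneOn_Icc_of_hasDerivWithinAt (f := fun t => Q t + 2 * t - P t)
      (f' := fun t => clip 0 M (U t) ^ 2 * clip 0 2 (V t) + 2 * 1
        - clip 0 M (U t) * clip 0 2 (V t) ^ 2)
      (fun t ht => ((H.hQ t ht).add ((hasDerivWithinAt_id _ _).const_mul 2)).sub (H.hP t ht))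
      (fun t ht => by
        have a1 := le_clip 0 M (U t)
        have a2 := le_clip 0 2 (V t)
        have a3 : clip 0 2 (V t) ≤ 2 := clip_le (by norm_num) _
        generalize clip 0 M (U t) = u at *
        generalize clip 0 2 (V t) = v at *
        nlinarith [mul_nonneg a2 (sq_nonneg (u - 1)), mul_nonneg (mul_nonneg a1 a2)
          (sub_nonneg.2 a3)]) h0 ht ht.1
    simp only [H.Q_zero, H.P_zero] at this
    linarith [hQn t ht, ht.2]
  have hU0 : ∀ t ∈ Icc 0 T, 0 ≤ U t := fun t ht => hh.trans (H.U_zero ▸ H.U_mono h0 ht ht.1)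
  have hUd : ∀ t ∈ Icc 0 T, HasDerivWithinAt U (P t) (Icc 0 T) t := fun t ht => by
    have := H.hU t ht
    rwa [clip_eq_self (by linarith [hP1 t ht]) ((hP2 t ht).trans hM')] at this
  have hU2 : ∀ t ∈ Icc 0 T, U t ≤ M := by
    intro t ht
    have := antitoneOn_Icc_of_hasDerivWithinAt (f := fun t => U t - (3 + 2 * T) * t)
      (f' := fun t => P t - (3 + 2 * T) * 1)
      (fun t ht => (hUd t ht).sub ((hasDerivWithinAt_id _ _).const_mul _))
      (fun t ht => by linarith [hP2 t ht]) h0 ht ht.1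
    simp only [H.U_zero] at this
    nlinarith [ht.2]
  refine ⟨hh, hh2, H.U_zero, H.V_zero, H.P_zero, H.Q_zero, hV, hUd, ?_, ?_, ?_, hU0, hV0, hQn⟩
  · intro t ht
    have := H.hV t ht
    rwa [clip_eq_self (hQ1 t ht) (hQn t ht)] at this
  · intro t ht
    have := H.hP t ht
    rwa [clip_eq_self (hU0 t ht) (hU2 t ht), clip_eq_self (hV0 t ht) (hV2 t ht)] at this
  · intro t ht
    have := H.hQ t ht
    rwa [clip_eq_self (hU0 t ht) (hU2 t ht), clip_eq_self (hV0 t ht) (hV2 t ht)] at this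

end IsClippedTrajectory

/-- Shooting in `h ∈ [0, 2]`: `V(T)` depends continuously on `h`, is nonpositive for `h = 0` because
`V` decreases, and positive for `h = 2`. -/
theorem exists_isHalfProfile {T : ℝ} (hT : 1 ≤ T) :
    ∃ (h : ℝ) (U V P Q : ℝ → ℝ), IsHalfProfile T h U V P Q := by
  have hT0 : 0 ≤ T := by linarith
  -- Chosen to exceed the a priori bounds `3 + 2T` for `P` and `2 + (3 + 2T)T` for `U`.
  set M : ℝ := 5 + (3 + 2 * T) * (T + 1) with hMdef
  have hM : 0 ≤ M := by positivity
  obtain ⟨K, B, hK, hB⟩ := exists_lipschitzWith_clipped hM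
  obtain ⟨γ, hγ, hγc⟩ := exists_flow_of_lipschitz_of_bounded hK hB hT0 2
  let init : ℝ → ℝ × ℝ × ℝ × ℝ := fun h => (h, h, 1, -1)
  have hinit : ∀ h ∈ Icc (0 : ℝ) 2, init h ∈ Metric.closedBall (0 : ℝ × ℝ × ℝ × ℝ) (2 : NNReal) := by
    intro h hh
    simp only [init, mem_closedBall_zero_iff, Prod.norm_def, Real.norm_eq_abs, NNReal.coe_ofNat]
    simp [abs_of_nonneg hh.1, hh.2]
  have htraj : ∀ h ∈ Icc (0 : ℝ) 2, IsClippedTrajectory M T h (fun t => (γ (init h) t).1)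
      (fun t => (γ (init h) t).2.1) (fun t => (γ (init h) t).2.2.1)
      (fun t => (γ (init h) t).2.2.2) := by
    intro h hh
    obtain ⟨h0, hd⟩ := hγ _ (hinit h hh)
    refine ⟨by simp [h0, init], by simp [h0, init], by simp [h0, init], by simp [h0, init],
      ?_, ?_, ?_, ?_⟩
    · exact fun t ht => (hd t ht).fst
    · exact fun t ht => (hd t ht).snd.fst
    · exact fun t ht => (hd t ht).snd.snd.fst
    · exact fun t ht => (hd t ht).snd.snd.snd
  have hcont : ContinuousOn (fun h => (γ (init h) T).2.1) (Icc 0 2) := by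
    have : ContinuousOn (fun h => γ (init h) T) (Icc 0 2) :=
      hγc.comp (by fun_prop) hinit
    exact (continuous_fst.comp continuous_snd).comp_continuousOn this
  have hm0 : (0 : ℝ) ∈ Icc (0 : ℝ) 2 := by simp
  have hm2 : (2 : ℝ) ∈ Icc (0 : ℝ) 2 := by simp
  have hlo : (γ (init 0) T).2.1 ≤ 0 := by
    have H := htraj 0 hm0
    have := H.V_anti (left_mem_Icc.2 hT0) (right_mem_Icc.2 hT0) hT0
    rwa [H.V_zero] at this
  have hhi : 0 ≤ (γ (init 2) T).2.1 := ((htraj 2 hm2).V_end_pos (by rw [hMdef]; nlinarith) hT).le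
  obtain ⟨h, hh, hV⟩ := intermediate_value_Icc (by norm_num) hcont ⟨hlo, hhi⟩
  exact ⟨h, _, _, _, _, (htraj h hh).isHalfProfile hT0 hh.1 hh.2 (by rw [hMdef]; nlinarith)
    (by rw [hMdef]; nlinarith) hV⟩

/-! ### Estimates for half profiles, uniform in `T`. -/

namespace IsHalfProfile

variable {T h : ℝ} {U V P Q : ℝ → ℝ}

theorem Q_mono (H : IsHalfProfile T h U V P Q) : MonotoneOn Q (Icc 0 T) :=
  monotoneOn_Icc_of_hasDerivWithinAt H.hQ fun t ht => mul_nonneg (sq_nonneg _) (H.V_nonneg t ht)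

theorem V_anti (H : IsHalfProfile T h U V P Q) : AntitoneOn V (Icc 0 T) :=
  antitoneOn_Icc_of_hasDerivWithinAt H.hV H.Q_nonpos

theorem V_le (H : IsHalfProfile T h U V P Q) {t : ℝ} (ht : t ∈ Icc 0 T) : V t ≤ 2 := by
  have := H.V_anti (left_mem_Icc.2 (ht.1.trans ht.2)) ht ht.1
  linarith [H.V_zero, H.h_le]

/-- The energy `(U')² + (V')² - U² V²` is conserved. -/
theorem energy (H : IsHalfProfile T h U V P Q) {t : ℝ} (ht : t ∈ Icc 0 T) :
    P t ^ 2 + Q t ^ 2 - U t ^ 2 * V t ^ 2 = 2 - h ^ 4 := by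
  have hd : ∀ t ∈ Icc 0 T,
      HasDerivWithinAt (fun t => P t ^ 2 + Q t ^ 2 - U t ^ 2 * V t ^ 2) 0 (Icc 0 T) t := by
    intro t ht
    have := (((H.hP t ht).pow 2).add ((H.hQ t ht).pow 2)).sub
      (((H.hU t ht).pow 2).mul ((H.hV t ht).pow 2))
    refine this.congr_deriv ?_
    simp
    ring
  have h0 := left_mem_Icc.2 (ht.1.trans ht.2)
  have h1 := monotoneOn_Icc_of_hasDerivWithinAt hd (fun _ _ => le_rfl) h0 ht ht.1
  have h2 := antitoneOn_Icc_of_hasDerivWithinAt hd (fun _ _ => le_rfl) h0 ht ht.1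
  simp only [H.P_zero, H.Q_zero, H.U_zero, H.V_zero] at h1 h2
  linarith

theorem P_mono (H : IsHalfProfile T h U V P Q) : MonotoneOn P (Icc 0 T) :=
  monotoneOn_Icc_of_hasDerivWithinAt H.hP fun t ht => mul_nonneg (H.U_nonneg t ht) (sq_nonneg _)

theorem one_le_P (H : IsHalfProfile T h U V P Q) {t : ℝ} (ht : t ∈ Icc 0 T) : 1 ≤ P t :=
  H.P_zero ▸ H.P_mono (left_mem_Icc.2 (ht.1.trans ht.2)) ht ht.1

theorem le_U (H : IsHalfProfile T h U V P Q) {t : ℝ} (ht : t ∈ Icc 0 T) : h + t ≤ U t := by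
  have := monotoneOn_Icc_of_hasDerivWithinAt (f := fun t => U t - t) (f' := fun t => P t - 1)
    (fun t ht => (H.hU t ht).sub (hasDerivWithinAt_id _ _))
    (fun t ht => by linarith [H.one_le_P ht]) (left_mem_Icc.2 (ht.1.trans ht.2)) ht ht.1
  simp only [H.U_zero] at this
  linarith

theorem neg_one_le_Q (H : IsHalfProfile T h U V P Q) {t : ℝ} (ht : t ∈ Icc 0 T) : -1 ≤ Q t :=
  H.Q_zero ▸ H.Q_mono (left_mem_Icc.2 (ht.1.trans ht.2)) ht ht.1

/-- The decisive inequality: since `V T = 0`, the conserved energy `2 - h⁴` equals `P(T)² + Q(T)²`.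
-/
theorem P_end_sq_le (H : IsHalfProfile T h U V P Q) (hT : 0 ≤ T) : P T ^ 2 ≤ 2 := by
  have := H.energy (right_mem_Icc.2 hT)
  rw [H.V_end] at this
  have h4 : 0 ≤ h ^ 4 := by have := H.h_nonneg; positivity
  nlinarith [sq_nonneg (Q T)]

/-- `V` and `Q` cannot vanish together, as in uniqueness for linear equations. With `M` a bound for
`U`, the quantity `(Q - M V) e^{Mt}` is nonincreasing and starts at a negative value. -/
theorem Q_neg (H : IsHalfProfile T h U V P Q) {t : ℝ} (ht : t ∈ Icc 0 T) (hV : V t = 0) :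
    Q t < 0 := by
  have hT := ht.1.trans ht.2
  have hUc : ContinuousOn U (Icc 0 T) := fun t ht => (H.hU t ht).continuousWithinAt
  obtain ⟨C, hC⟩ := isCompact_Icc.exists_bound_of_continuousOn hUc
  set M := max C 0
  have hM : 0 ≤ M := le_max_right _ _
  have := antitoneOn_Icc_of_hasDerivWithinAt
    (f := fun t => (Q t - M * V t) * Real.exp (M * t))
    (f' := fun t => (U t ^ 2 - M ^ 2) * V t * Real.exp (M * t))
    (fun t ht => by
      have := ((H.hQ t ht).sub ((H.hV t ht).const_mul M)).mul
        ((((hasDerivWithinAt_id t (Icc 0 T)).const_mul M)).exp)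
      refine this.congr_deriv ?_
      simp
      ring)
    (fun t ht => by
      have h1 : U t ≤ M := (le_abs_self _).trans ((hC t ht).trans (le_max_left _ _))
      have h2 := H.U_nonneg t ht
      have h3 : U t ^ 2 - M ^ 2 ≤ 0 := by nlinarith
      have h4 := H.V_nonneg t ht
      exact mul_nonpos_of_nonpos_of_nonneg (mul_nonpos_of_nonpos_of_nonneg h3 h4)
        (Real.exp_pos _).le) (left_mem_Icc.2 hT) ht ht.1
  simp only [H.Q_zero, H.V_zero, hV, mul_zero, Real.exp_zero, mul_one, sub_zero] at this
  by_contra! hq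
  have h5 : 0 ≤ Q t * Real.exp (M * t) := mul_nonneg hq (Real.exp_pos _).le
  nlinarith [H.h_nonneg]

/-- An interior zero would be a minimum of `V`, forcing `Q = 0` there, against `Q_neg`. -/
theorem V_pos_of_mem_Ioo (H : IsHalfProfile T h U V P Q) {t : ℝ} (ht : t ∈ Ioo 0 T) : 0 < V t := by
  have htc := Ioo_subset_Icc_self ht
  refine (H.V_nonneg t htc).lt_of_ne' fun h0 => ?_
  have hn : Icc 0 T ∈ 𝓝 t := Icc_mem_nhds ht.1 ht.2
  have hmin : IsLocalMin V t := by
    filter_upwards [hn] with s hs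
    rw [h0]
    exact H.V_nonneg s hs
  have := hmin.hasDerivAt_eq_zero ((H.hV t htc).hasDerivAt hn)
  linarith [H.Q_neg htc h0]

theorem h_pos (H : IsHalfProfile T h U V P Q) (hT : 0 < T) : 0 < h := by
  have hm : T / 2 ∈ Ioo 0 T := ⟨by linarith, by linarith⟩
  have h1 := H.V_pos_of_mem_Ioo hm
  have h2 := H.V_anti (left_mem_Icc.2 hT.le) (Ioo_subset_Icc_self hm) hm.1.le
  linarith [H.V_zero]

theorem V_pos (H : IsHalfProfile T h U V P Q) {t : ℝ} (ht : t ∈ Ico 0 T) : 0 < V t := by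
  rcases ht.1.eq_or_lt with h0 | h0
  · rw [← h0, H.V_zero]
    exact H.h_pos (ht.1.trans_lt ht.2)
  · exact H.V_pos_of_mem_Ioo ⟨h0, ht.2⟩

/-- `V` is convex, nonnegative and at most `2` at the origin: its tangent slope at `t` is bounded by
the mean slope on `[0, t]`. -/
theorem neg_Q_mul_le (H : IsHalfProfile T h U V P Q) {t : ℝ} (ht : t ∈ Icc 0 T) :
    -Q t * t ≤ 2 := by
  have hsub : Icc 0 t ⊆ Icc 0 T := Icc_subset_Icc_right ht.2
  have := antitoneOn_Icc_of_hasDerivWithinAt (f := fun s => V s - Q t * s)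
    (f' := fun s => Q s - Q t * 1) (a := 0) (b := t)
    (fun s hs => ((H.hV s (hsub hs)).mono hsub).sub ((hasDerivWithinAt_id _ _).const_mul _))
    (fun s hs => by linarith [H.Q_mono (hsub hs) ht hs.2])
    (left_mem_Icc.2 ht.1) (right_mem_Icc.2 ht.1) ht.1
  simp only [H.V_zero] at this
  linarith [H.V_nonneg t ht, H.h_le]

/-- For `s ≥ t`, `U ≥ t` and `V ≤ 2` give `t U V² ≤ 2 U² V`, that is `t P' ≤ 2 Q'`. Integrating from
`t` to `T` leaves at most `-2 Q(t)`, which is `O(1/t)` by `neg_Q_mul_le`. -/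
theorem P_end_sub_mul_sq_le (H : IsHalfProfile T h U V P Q) {t : ℝ} (ht : t ∈ Icc 0 T) :
    (P T - P t) * t ^ 2 ≤ 4 := by
  have hsub : Icc t T ⊆ Icc 0 T := Icc_subset_Icc_left ht.1
  have := antitoneOn_Icc_of_hasDerivWithinAt (f := fun s => t * P s - 2 * Q s)
    (f' := fun s => t * (U s * V s ^ 2) - 2 * (U s ^ 2 * V s)) (a := t) (b := T)
    (fun s hs => (((H.hP s (hsub hs)).mono hsub).const_mul _).sub
      (((H.hQ s (hsub hs)).mono hsub).const_mul _))
    (fun s hs => by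
      have h1 := H.le_U (hsub hs)
      have h2 := H.V_nonneg s (hsub hs)
      have h3 := H.V_le (hsub hs)
      have h4 := H.h_nonneg
      have h5 : t * V s ≤ U s * 2 :=
        mul_le_mul (by linarith [hs.1]) h3 h2 (H.U_nonneg s (hsub hs))
      nlinarith [mul_nonneg (H.U_nonneg s (hsub hs)) h2])
    (left_mem_Icc.2 ht.2) (right_mem_Icc.2 ht.2) ht.2
  have h1 := H.Q_nonpos T (right_mem_Icc.2 (ht.1.trans ht.2))
  have h2 := H.neg_Q_mul_le ht
  have h3 : t * (P T - P t) ≤ 2 * (-Q t) := by linarith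
  nlinarith [mul_le_mul_of_nonneg_right h3 ht.1]

theorem U_sub_le (H : IsHalfProfile T h U V P Q) {t : ℝ} (ht : t ∈ Icc 0 T) :
    U t - P T * t ≤ 2 := by
  have := antitoneOn_Icc_of_hasDerivWithinAt (f := fun s => U s - P T * s)
    (f' := fun s => P s - P T * 1)
    (fun s hs => (H.hU s hs).sub ((hasDerivWithinAt_id _ _).const_mul _))
    (fun s hs => by linarith [H.P_mono hs (right_mem_Icc.2 (hs.1.trans hs.2)) hs.2])
    (left_mem_Icc.2 (ht.1.trans ht.2)) ht ht.1
  simp only [H.U_zero] at this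
  linarith [H.h_le]

theorem P_end_lt (H : IsHalfProfile T h U V P Q) (hT : 0 ≤ T) : P T < 3 / 2 := by
  nlinarith [H.P_end_sq_le hT]

/-- The slope defect `P(T) - P(s) ≤ 4/s²` is integrable at infinity, so `U` stays within a constant,
independent of `T`, of the line of slope `P(T)`. Times up to `2` are handled directly by `U ≥ h +
t`. -/
theorem le_U_sub (H : IsHalfProfile T h U V P Q) {t : ℝ} (ht : t ∈ Icc 0 T) :
    -5 ≤ U t - P T * t := by
  have hT := ht.1.trans ht.2
  have hPT := H.P_end_lt hT
  have key : ∀ s ∈ Icc 0 T, s ≤ 2 → -1 ≤ U s - P T * s := by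
    intro s hs hs2
    have := H.le_U hs
    nlinarith [hs.1, H.h_nonneg]
  rcases le_total t 2 with h2 | h2
  · linarith [key t ht h2]
  have h2T : (2 : ℝ) ∈ Icc 0 T := ⟨by norm_num, h2.trans ht.2⟩
  have hsub : Icc 2 t ⊆ Icc 0 T := Icc_subset_Icc h2T.1 ht.2
  -- The term `-4/s` is a primitive of the bound `4/s²` on the slope defect.
  have := monotoneOn_Icc_of_hasDerivWithinAt (f := fun s => U s - P T * s - 4 * s⁻¹)
    (f' := fun s => P s - P T * 1 - 4 * (-(s ^ 2)⁻¹)) (a := 2) (b := t)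
    (fun s hs => (((H.hU s (hsub hs)).mono hsub).sub ((hasDerivWithinAt_id _ _).const_mul _)).sub
      ((hasDerivWithinAt_inv (by linarith [hs.1]) _).const_mul 4))
    (fun s hs => by
      have h1 := H.P_end_sub_mul_sq_le (hsub hs)
      have h0 : 0 < s := by linarith [hs.1]
      have h3 : P T - P s ≤ 4 * (s ^ 2)⁻¹ := by
        rw [← div_eq_mul_inv, le_div_iff₀ (by positivity)]
        exact h1
      linarith)
    (left_mem_Icc.2 h2) (right_mem_Icc.2 h2) h2
  simp only at this
  have h4 : 0 ≤ 4 * t⁻¹ := by have := ht.1; positivity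
  linarith [key 2 h2T le_rfl]

end IsHalfProfile

/-! ### Reflection to a full profile, and convergence of the slopes. -/

/-- Two differentiable functions on `[0, T]` with matching data at `0` give a differentiable
function on `(-T, T)`, the second one being reflected to negative times. -/
theorem hasDerivAt_glue_neg {f g f' g' : ℝ → ℝ} {T : ℝ}
    (hf : ∀ t ∈ Icc 0 T, HasDerivWithinAt f (f' t) (Icc 0 T) t)
    (hg : ∀ t ∈ Icc 0 T, HasDerivWithinAt g (g' t) (Icc 0 T) t) (h0 : f 0 = g 0)
    (h0' : f' 0 = -g' 0) {t : ℝ} (ht : t ∈ Ioo (-T) T) :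
    HasDerivAt (fun t => if 0 ≤ t then f t else g (-t)) (if 0 ≤ t then f' t else -g' (-t)) t := by
  rcases lt_trichotomy t 0 with hneg | rfl | hpos
  · have hn : Icc 0 T ∈ 𝓝 (-t) := Icc_mem_nhds (by linarith) (by linarith [ht.1])
    have h1 := ((hg (-t) ⟨by linarith, by linarith [ht.1]⟩).hasDerivAt hn).comp t (hasDerivAt_neg t)
    rw [if_neg hneg.not_ge]
    refine (h1.congr_deriv (by ring)).congr_of_eventuallyEq ?_
    filter_upwards [Iio_mem_nhds hneg] with s hs
    simp [not_le.2 (show s < 0 from hs)]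
  · have hT : 0 < T := ht.2
    have hm : (0 : ℝ) ∈ Icc 0 T := ⟨le_rfl, hT.le⟩
    rw [if_pos le_rfl, ← hasDerivWithinAt_univ, ← Iic_union_Ici (a := (0 : ℝ))]
    refine HasDerivWithinAt.union ?_ ?_
    · have h1 : HasDerivWithinAt g (g' (-0)) (Ici 0) (-0) := by
        rw [neg_zero]
        exact (hg 0 hm).mono_of_mem_nhdsWithin (Icc_mem_nhdsGE hT)
      have h2 := h1.comp (0 : ℝ) (hasDerivAt_neg (0 : ℝ)).hasDerivWithinAt
        (s := Iic 0) (fun s hs => by simpa using! hs)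
      refine (h2.congr_deriv (by simp [h0'])).congr (fun s hs => ?_) (by simp [h0])
      rcases (show s ≤ 0 from hs).eq_or_lt with rfl | hs'
      · simp [h0]
      · simp [not_le.2 hs']
    · refine ((hf 0 hm).mono_of_mem_nhdsWithin (Icc_mem_nhdsGE hT)).congr (fun s hs => ?_) (by simp)
      simp [show 0 ≤ s from hs]
  · have hn : Icc 0 T ∈ 𝓝 t := Icc_mem_nhds hpos ht.2
    have h1 := (hf t ⟨hpos.le, ht.2.le⟩).hasDerivAt hn
    rw [if_pos hpos.le]
    refine h1.congr_of_eventuallyEq ?_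
    filter_upwards [Ioi_mem_nhds hpos] with s hs
    simp [le_of_lt (show 0 < s from hs)]

/-- Positive solutions on `(-T, T)` of `U''(t) = U(t) U(-t)²`, equivalently of the system
`U'' = U V²`, `V'' = U² V` with `V(t) = U(-t)`, normalized by `U'(0) = 1` and with slope `A` on the
right; `P = U'`. -/
structure IsProfile (T A : ℝ) (U P : ℝ → ℝ) : Prop where
  hU : ∀ t ∈ Ioo (-T) T, HasDerivAt U (P t) t
  hP : ∀ t ∈ Ioo (-T) T, HasDerivAt P (U t * U (-t) ^ 2) t
  pos : ∀ t ∈ Ioo (-T) T, 0 < U t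
  P_zero : P 0 = 1
  abs_P_le : ∀ t ∈ Ioo (-T) T, |P t| ≤ 2
  abs_U_sub_le : ∀ t ∈ Ioo (-T) T, |U t - A * max t 0| ≤ 5
  abs_P_sub_le : ∀ t ∈ Ioo 0 T, |P t - A| * t ^ 2 ≤ 4
  abs_P_mul_le : ∀ t ∈ Ioo (-T) 0, |P t| * |t| ≤ 2

theorem IsHalfProfile.isProfile {T h : ℝ} {U V P Q : ℝ → ℝ} (H : IsHalfProfile T h U V P Q) :
    IsProfile T (P T) (fun t => if 0 ≤ t then U t else V (-t))
      (fun t => if 0 ≤ t then P t else -Q (-t)) := by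
  have hr : ∀ t ∈ Ioo (-T) T, 0 ≤ t → t ∈ Icc 0 T := fun t ht h0 => ⟨h0, ht.2.le⟩
  have hl : ∀ t ∈ Ioo (-T) T, ¬ 0 ≤ t → -t ∈ Icc 0 T := fun t ht h0 =>
    ⟨by linarith, by linarith [ht.1]⟩
  refine ⟨?_, ?_, ?_, by simp [H.P_zero], ?_, ?_, ?_, ?_⟩
  · intro t ht
    exact hasDerivAt_glue_neg H.hU H.hV (by rw [H.U_zero, H.V_zero])
      (by rw [H.P_zero, H.Q_zero]; norm_num) ht
  · intro t ht
    have := hasDerivAt_glue_neg H.hP (fun t ht => (H.hQ t ht).neg)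
      (by simp [H.P_zero, H.Q_zero]) (by simp [H.U_zero, H.V_zero]; ring) ht
    refine this.congr_deriv ?_
    rcases lt_trichotomy t 0 with h0 | rfl | h0
    · simp [not_le.2 h0, h0.le]; ring
    · simp [H.U_zero, H.V_zero]
    · simp [h0.le, not_le.2 h0]
  · intro t ht
    split_ifs with h0
    · linarith [H.le_U (hr t ht h0), H.h_pos (by linarith [ht.1, ht.2])]
    · exact H.V_pos ⟨by linarith, by linarith [ht.1]⟩
  · intro t ht
    have hT : 0 ≤ T := by linarith [ht.1, ht.2]
    split_ifs with h0
    · rw [abs_le]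
      constructor <;> linarith [H.one_le_P (hr t ht h0), H.P_end_lt hT,
        H.P_mono (hr t ht h0) (right_mem_Icc.2 hT) ht.2.le]
    · rw [abs_le]
      constructor <;> linarith [H.neg_one_le_Q (hl t ht h0), H.Q_nonpos _ (hl t ht h0)]
  · intro t ht
    split_ifs with h0
    · rw [max_eq_left h0, abs_le]
      constructor <;> linarith [H.le_U_sub (hr t ht h0), H.U_sub_le (hr t ht h0)]
    · rw [max_eq_right (not_le.1 h0).le, abs_le]
      constructor <;> linarith [H.V_nonneg _ (hl t ht h0), H.V_le (hl t ht h0)]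
  · intro t ht
    have hc := Ioo_subset_Icc_self ht
    have h1 := H.P_end_sub_mul_sq_le hc
    have h2 := H.P_mono hc (right_mem_Icc.2 (ht.1.trans ht.2).le) ht.2.le
    simp only [ht.1.le, if_true]
    rwa [abs_sub_comm, abs_of_nonneg (by linarith)]
  · intro t ht
    have hc : -t ∈ Icc 0 T := ⟨by linarith [ht.2], by linarith [ht.1]⟩
    simp only [not_le.2 ht.2, if_false]
    rw [abs_neg, abs_of_nonpos (H.Q_nonpos _ hc), abs_of_neg ht.2]
    exact H.neg_Q_mul_le hc

/-- Profiles on intervals exhausting the line, with converging slopes. -/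
theorem exists_seq_isProfile : ∃ (m : ℕ → ℝ) (A : ℕ → ℝ) (a : ℝ) (U P : ℕ → ℝ → ℝ),
    (∀ n, 1 ≤ m n) ∧ Tendsto m atTop atTop ∧ Tendsto A atTop (𝓝 a) ∧ 1 ≤ a ∧ a ≤ 3 / 2 ∧
    ∀ n, IsProfile (m n) (A n) (U n) (P n) := by
  choose h U V P Q H using fun n : ℕ =>
    exists_isHalfProfile (T := (n : ℝ) + 1) (by linarith [n.cast_nonneg (α := ℝ)])
  have hT : ∀ n : ℕ, (0 : ℝ) ≤ n + 1 := fun n => by positivity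
  have hA : ∀ n : ℕ, P n (n + 1) ∈ Icc (1 : ℝ) (3 / 2) := fun n =>
    ⟨(H n).one_le_P (right_mem_Icc.2 (hT n)), ((H n).P_end_lt (hT n)).le⟩
  obtain ⟨a, ha, φ, hφ, hlim⟩ := isCompact_Icc.tendsto_subseq hA
  refine ⟨fun n => φ n + 1, _, a, _, _, fun n => ?_, ?_, hlim, ha.1, ha.2,
    fun n => (H (φ n)).isProfile⟩
  · linarith [(φ n).cast_nonneg (α := ℝ)]
  · exact tendsto_atTop_add_const_right _ _ (tendsto_natCast_atTop_atTop.comp hφ.tendsto_atTop)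

/-! ### Bounds in `C^{1,α}` force convergence of gradients. -/

/-- The gradient estimate behind compactness in `C¹`: a function whose gradient is `α`-Hölder near
`y` agrees with its first order expansion up to `C ‖z - y‖ ^ (1 + α)`. -/
theorem abs_sub_sub_inner_gradient_le {X : Type*} [NormedAddCommGroup X] [InnerProductSpace ℝ X]
    [CompleteSpace X] {w : X → ℝ} {s : Set X} {C α : ℝ} (hs : Convex ℝ s) (hC : 0 ≤ C) (hα : 0 ≤ α)
    (hd : ∀ x ∈ s, DifferentiableAt ℝ w x)
    (hw : ∀ x ∈ s, ∀ y ∈ s, ‖gradient w x - gradient w y‖ ≤ C * ‖x - y‖ ^ α)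
    {y z : X} (hy : y ∈ s) (hz : z ∈ s) :
    |w z - w y - inner ℝ (gradient w y) (z - y)| ≤ C * ‖z - y‖ ^ α * ‖z - y‖ := by
  have hseg : segment ℝ y z ⊆ s := hs.segment_subset hy hz
  have := (convex_segment y z).norm_image_sub_le_of_norm_hasFDerivWithin_le'
    (f := w) (f' := fun x => fderiv ℝ w x) (φ := fderiv ℝ w y) (C := C * ‖z - y‖ ^ α)
    (fun x hx => (hd x (hseg hx)).hasFDerivAt.hasFDerivWithinAt) (fun x hx => ?_)
    (left_mem_segment ℝ y z) (right_mem_segment ℝ y z)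
  · rwa [← inner_gradient_left, Real.norm_eq_abs] at this
  · have h1 : ‖fderiv ℝ w x - fderiv ℝ w y‖ = ‖gradient w x - gradient w y‖ := by
      rw [← toDual_gradient, ← toDual_gradient, ← map_sub, LinearIsometryEquiv.norm_map]
    rw [h1]
    refine (hw x (hseg hx) y hy).trans ?_
    gcongr
    have := norm_sub_le_of_mem_segment hx
    rwa [norm_sub_rev z y, norm_sub_rev x y, norm_sub_rev y z] at *

/-- If functions converging pointwise have gradients that are bounded and uniformly `α`-Hölder on
a ball, then their gradients converge along every sequence converging to the centre. -/
theorem tendsto_gradient_of_holder {X : Type*} [NormedAddCommGroup X] [InnerProductSpace ℝ X]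
    [FiniteDimensional ℝ X] {w : ℕ → X → ℝ} {w₀ : X → ℝ} {x₀ : X} {x : ℕ → X} {ρ C α : ℝ}
    (hρ : 0 < ρ) (hα : 0 < α) (hx : Tendsto x atTop (𝓝 x₀))
    (hd : ∀ n, ∀ y ∈ Metric.ball x₀ ρ, DifferentiableAt ℝ (w n) y)
    (hlim : ∀ y ∈ Metric.ball x₀ ρ, Tendsto (fun n => w n y) atTop (𝓝 (w₀ y)))
    (hlim' : Tendsto (fun n => w n (x n)) atTop (𝓝 (w₀ x₀)))
    (hb : ∀ n, ∀ y ∈ Metric.ball x₀ ρ, ‖gradient (w n) y‖ ≤ C)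
    (hh : ∀ n, ∀ y ∈ Metric.ball x₀ ρ, ∀ z ∈ Metric.ball x₀ ρ,
      ‖gradient (w n) y - gradient (w n) z‖ ≤ C * ‖y - z‖ ^ α) :
    Tendsto (fun n => gradient (w n) (x n)) atTop (𝓝 (gradient w₀ x₀)) := by
  have hx₀ : x₀ ∈ Metric.ball x₀ ρ := Metric.mem_ball_self hρ
  have hC : 0 ≤ C := (norm_nonneg _).trans (hb 0 x₀ hx₀)
  have hxev : ∀ᶠ n in atTop, x n ∈ Metric.ball x₀ ρ := hx.eventually (Metric.ball_mem_nhds _ hρ)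
  refine tendsto_of_subseq_tendsto fun ns hns => ?_
  have hbd : ∃ᶠ n in atTop, gradient (w (ns n)) (x (ns n)) ∈ Metric.closedBall (0 : X) C := by
    refine Eventually.frequently ?_
    filter_upwards [hns.eventually hxev] with n hn
    simpa using hb (ns n) _ hn
  obtain ⟨p, -, φ, hφ, hp⟩ :=
    (isCompact_closedBall (0 : X) C).tendsto_subseq' hbd
  refine ⟨φ, ?_⟩
  have hψ : Tendsto (fun k => ns (φ k)) atTop atTop := hns.comp hφ.tendsto_atTop
  -- The cluster point `p` belongs to an arbitrary subsequence. Showing that it is a gradient of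
  -- `w₀` gives both the differentiability of `w₀` and the independence of the subsequence.
  suffices HasGradientAt w₀ p x₀ by rwa [this.gradient]
  have key : ∀ y ∈ Metric.ball x₀ ρ,
      |w₀ y - w₀ x₀ - inner ℝ p (y - x₀)| ≤ C * ‖y - x₀‖ ^ α * ‖y - x₀‖ := by
    intro y hy
    have hyx : Tendsto (fun k => y - x (ns (φ k))) atTop (𝓝 (y - x₀)) :=
      tendsto_const_nhds.sub (hx.comp hψ)
    have h1 : Tendsto (fun k => |w (ns (φ k)) y - w (ns (φ k)) (x (ns (φ k)))
        - inner ℝ (gradient (w (ns (φ k))) (x (ns (φ k)))) (y - x (ns (φ k)))|) atTop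
        (𝓝 |w₀ y - w₀ x₀ - inner ℝ p (y - x₀)|) :=
      ((((hlim y hy).comp hψ).sub (hlim'.comp hψ)).sub (hp.inner hyx)).abs
    have h2 : Tendsto (fun k => C * ‖y - x (ns (φ k))‖ ^ α * ‖y - x (ns (φ k))‖) atTop
        (𝓝 (C * ‖y - x₀‖ ^ α * ‖y - x₀‖)) :=
      (tendsto_const_nhds.mul (hyx.norm.rpow_const (Or.inr hα.le))).mul hyx.norm
    refine le_of_tendsto_of_tendsto h1 h2 ?_
    filter_upwards [hψ.eventually hxev] with k hk
    exact abs_sub_sub_inner_gradient_le (convex_ball x₀ ρ) hC hα.le (hd _) (hh _) hk hy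
  rw [hasGradientAt_iff_isLittleO]
  have hsmall : Tendsto (fun y => C * ‖y - x₀‖ ^ α) (𝓝 x₀) (𝓝 0) := by
    have : Tendsto (fun y : X => ‖y - x₀‖) (𝓝 x₀) (𝓝 0) := by
      have : Continuous fun y : X => ‖y - x₀‖ := by fun_prop
      simpa using! this.tendsto x₀
    simpa [Real.zero_rpow hα.ne'] using! (this.rpow_const (Or.inr hα.le)).const_mul C
  rw [Asymptotics.isLittleO_iff]
  intro c hc
  filter_upwards [Metric.ball_mem_nhds x₀ hρ, hsmall.eventually (gt_mem_nhds hc)] with y hy hyc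
  refine (key y hy).trans ?_
  gcongr

namespace Competition

theorem TendstoHolderLoc.tendsto_apply {N : ℕ} {Ω : Set (E N)} {α : ℝ} {w : ℕ → E N → ℝ}
    {w₀ : E N → ℝ} (h : TendstoHolderLoc Ω α w w₀) (hΩ : IsOpen Ω) {x₀ : E N} (hx₀ : x₀ ∈ Ω)
    (hw₀ : ContinuousAt w₀ x₀) {x : ℕ → E N} (hx : Tendsto x atTop (𝓝 x₀)) :
    Tendsto (fun n => w n (x n)) atTop (𝓝 (w₀ x₀)) := by
  obtain ⟨r, hr, hrΩ⟩ := Metric.isOpen_iff.1 hΩ x₀ hx₀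
  have hdiff : Tendsto (fun n => w n (x n) - w₀ (x n)) atTop (𝓝 0) := by
    rw [Metric.tendsto_nhds]
    intro ε hε
    have hsub : Metric.closedBall x₀ (r / 2) ⊆ Ω :=
      (Metric.closedBall_subset_ball (half_lt_self hr)).trans hrΩ
    filter_upwards [h _ (isCompact_closedBall x₀ (r / 2)) hsub (ε / 2) (half_pos hε),
      hx.eventually (Metric.closedBall_mem_nhds x₀ (half_pos hr))] with n hn hxn
    rw [Real.dist_eq, sub_zero]
    exact (hn.1 _ hxn).trans_lt (half_lt_self hε)
  simpa using hdiff.add (hw₀.tendsto.comp hx)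

theorem IsSegregatingSequence.not_boundedC1Holder {N : ℕ} {Ω : Set (E N)}
    {a : Fin 2 → Fin 2 → ℝ} {β : ℕ → ℝ} {fβ : ℕ → Fin 2 → E N → ℝ → ℝ} {f : Fin 2 → E N → ℝ → ℝ}
    {uβ : ℕ → Fin 2 → E N → ℝ} {u : Fin 2 → E N → ℝ} {x : ℕ → E N} {x₀ : E N}
    (H : IsSegregatingSequence Ω a β fβ f uβ u) (hx : Tendsto x atTop (𝓝 x₀))
    (hlim : ¬ Tendsto (fun n => gradient (fun y => uβ n 0 y - uβ n 1 y) (x n)) atTop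
      (𝓝 (gradient (fun y => u 0 y - u 1 y) x₀))) {α : ℝ} (hα : α ∈ Ioo (0 : ℝ) 1) {ρ : ℝ}
    (hρ : 0 < ρ) (hball : Metric.ball x₀ ρ ⊆ Ω) :
    ¬ BoundedC1Holder (Metric.ball x₀ ρ) α (fun n y => uβ n 0 y - uβ n 1 y) := by
  rintro ⟨C, hC⟩
  have hcont : ∀ i, ∀ y ∈ Ω, ContinuousAt (u i) y := fun i y hy =>
    (H.limit_lipschitz i).continuousOn.continuousAt (H.isOpen.mem_nhds hy)
  have happ : ∀ y ∈ Ω, ∀ z : ℕ → E N, Tendsto z atTop (𝓝 y) →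
      Tendsto (fun n => uβ n 0 (z n) - uβ n 1 (z n)) atTop (𝓝 (u 0 y - u 1 y)) :=
    fun y hy z hz =>
      ((H.tendsto_holder 0 α hα).tendsto_apply H.isOpen hy (hcont 0 y hy) hz).sub
        ((H.tendsto_holder 1 α hα).tendsto_apply H.isOpen hy (hcont 1 y hy) hz)
  have hdiff : ∀ n i, ∀ y ∈ Ω, DifferentiableAt ℝ (uβ n i) y := fun n i y hy =>
    (((H.solution n).contDiffOn i).differentiableOn one_ne_zero).differentiableAt
      (H.isOpen.mem_nhds hy)
  refine hlim (tendsto_gradient_of_holder (w := fun n y => uβ n 0 y - uβ n 1 y)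
    (w₀ := fun y => u 0 y - u 1 y) hρ hα.1 hx
    (fun n y hy => (hdiff n 0 y (hball hy)).sub (hdiff n 1 y (hball hy)))
    (fun y hy => happ y (hball hy) _ tendsto_const_nhds)
    (happ x₀ (hball (Metric.mem_ball_self hρ)) x hx) (fun n => (hC n).2.1) fun n => (hC n).2.2)

end Competition

/-! ### Integrals over the sphere and the frequency of the limit profile. -/

/-- A linear isometry, restricted to the unit sphere. -/
def LinearIsometryEquiv.unitSphere {X : Type*} [NormedAddCommGroup X] [NormedSpace ℝ X]
    (g : X ≃ₗᵢ[ℝ] X) (θ : Metric.sphere (0 : X) 1) : Metric.sphere (0 : X) 1 :=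
  ⟨g θ, by simp⟩

theorem LinearIsometryEquiv.continuous_unitSphere {X : Type*} [NormedAddCommGroup X]
    [NormedSpace ℝ X] (g : X ≃ₗᵢ[ℝ] X) : Continuous g.unitSphere :=
  (g.continuous.comp continuous_subtype_val).subtype_mk _

/-- The surface measure of the unit sphere is invariant under linear isometries. -/
theorem LinearIsometryEquiv.measurePreserving_unitSphere {X : Type*} [NormedAddCommGroup X]
    [InnerProductSpace ℝ X] [FiniteDimensional ℝ X] [MeasurableSpace X] [BorelSpace X]
    (g : X ≃ₗᵢ[ℝ] X) :
    MeasurePreserving g.unitSphere (volume : Measure X).toSphere (volume : Measure X).toSphere := by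
  refine ⟨g.continuous_unitSphere.measurable, Measure.ext fun s hs => ?_⟩
  have hm : Measurable g.unitSphere := g.continuous_unitSphere.measurable
  -- `toSphere` measures a set through the volume of the cone over it, and a linear isometry maps
  -- cones to cones preserving volume.
  rw [Measure.map_apply hm hs, Measure.toSphere_apply' _ (hm hs), Measure.toSphere_apply' _ hs]
  congr 1
  refine Eq.trans ?_ (g.measurePreserving.measure_preimage_equiv (f := g.toMeasurableEquiv) _)
  congr 1
  ext x
  constructor
  · rintro ⟨r, hr, _, ⟨θ, hθ, rfl⟩, rfl⟩
    exact ⟨r, hr, _, ⟨g.unitSphere θ, hθ, rfl⟩, (_root_.map_smul g r (θ : X)).symm⟩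
  · rintro ⟨r, hr, _, ⟨θ, hθ, rfl⟩, hx⟩
    refine ⟨r, hr, _, ⟨g.symm.unitSphere θ, ?_, rfl⟩, ?_⟩
    · have : g.unitSphere (g.symm.unitSphere θ) = θ := Subtype.ext (g.apply_symm_apply _)
      rwa [mem_preimage, this]
    · apply g.injective
      refine Eq.trans ?_ hx
      change g (r • g.symm θ) = r • (θ : X)
      rw [_root_.map_smul, g.apply_symm_apply]

/-- The mean of the square of a coordinate over the unit sphere of `ℝ^N` is `1 / N`. -/
theorem integral_toSphere_coord_sq {N : ℕ} (k : Fin N) :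
    ∫ θ : Metric.sphere (0 : EuclideanSpace ℝ (Fin N)) 1, (θ : EuclideanSpace ℝ (Fin N)) k ^ 2
      ∂(volume : Measure (EuclideanSpace ℝ (Fin N))).toSphere =
    volume.real (Metric.ball (0 : EuclideanSpace ℝ (Fin N)) 1) := by
  have hN : 0 < N := k.pos
  set μ := (volume : Measure (EuclideanSpace ℝ (Fin N))).toSphere
  have hc : ∀ j : Fin N, Continuous fun θ : Metric.sphere (0 : EuclideanSpace ℝ (Fin N)) 1 =>
      (θ : EuclideanSpace ℝ (Fin N)) j ^ 2 := fun j => by fun_prop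
  have hint : ∀ j : Fin N, Integrable (fun θ : Metric.sphere (0 : EuclideanSpace ℝ (Fin N)) 1 =>
      (θ : EuclideanSpace ℝ (Fin N)) j ^ 2) μ := fun j =>
    (hc j).integrable_of_hasCompactSupport (HasCompactSupport.of_compactSpace _)
  -- Swapping two coordinates is an isometry, so all coordinates have the same second moment. These
  -- moments sum to the area of the sphere, which is `N` times the volume of the ball.
  have hsymm : ∀ j : Fin N, ∫ θ, (θ : EuclideanSpace ℝ (Fin N)) j ^ 2 ∂μ =
      ∫ θ, (θ : EuclideanSpace ℝ (Fin N)) k ^ 2 ∂μ := by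
    intro j
    let g := LinearIsometryEquiv.piLpCongrLeft 2 ℝ ℝ (Equiv.swap j k)
    have hg : MeasurePreserving g.unitSphere μ μ := g.measurePreserving_unitSphere
    conv_lhs => rw [← hg.map_eq]
    rw [integral_map hg.aemeasurable (hc j).aestronglyMeasurable]
    refine integral_congr_ae (.of_forall fun θ => ?_)
    simp [LinearIsometryEquiv.unitSphere, g, LinearIsometryEquiv.piLpCongrLeft_apply]
  have hsum : ∑ j : Fin N, ∫ θ, (θ : EuclideanSpace ℝ (Fin N)) j ^ 2 ∂μ =
      N * volume.real (Metric.ball (0 : EuclideanSpace ℝ (Fin N)) 1) := by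
    rw [← integral_finsetSum _ fun j _ => hint j]
    have : ∀ θ : Metric.sphere (0 : EuclideanSpace ℝ (Fin N)) 1,
        ∑ j, (θ : EuclideanSpace ℝ (Fin N)) j ^ 2 = 1 := by
      intro θ
      have := EuclideanSpace.real_norm_sq_eq (θ : EuclideanSpace ℝ (Fin N))
      rw [← this]
      simp
    simp [this, μ]
  rw [Finset.sum_congr rfl fun j _ => hsymm j] at hsum
  simp only [Finset.sum_const, Finset.card_univ, Fintype.card_fin, nsmul_eq_mul] at hsum
  exact mul_left_cancel₀ (by positivity) hsum

namespace Competition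

variable {N : ℕ}

theorem hasGradientAt_comp_coord {g : ℝ → ℝ} {g' : ℝ} {k : Fin N} {x : E N}
    (h : HasDerivAt g g' (x k)) :
    HasGradientAt (fun y : E N => g (y k)) (g' • EuclideanSpace.single k (1 : ℝ)) x := by
  rw [hasGradientAt_iff_hasFDerivAt]
  have h1 : HasFDerivAt (fun y : E N => y k)
      (EuclideanSpace.proj k : E N →L[ℝ] ℝ) x := (EuclideanSpace.proj k : E N →L[ℝ] ℝ).hasFDerivAt
  refine (h.comp_hasFDerivAt x h1).congr_fderiv ?_
  ext v
  simp [EuclideanSpace.inner_single_left]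

/-- Used to discard the kink of the limit profile, where its components are not differentiable. -/
theorem ae_coord_ne_zero (k : Fin N) : ∀ᵐ x : E N, x k ≠ 0 := by
  let S : Submodule ℝ (E N) := LinearMap.ker (EuclideanSpace.proj k : E N →L[ℝ] ℝ).toLinearMap
  have hS : S ≠ ⊤ := by
    intro h
    have : EuclideanSpace.single k (1 : ℝ) ∈ S := h ▸ Submodule.mem_top
    simp [S] at this
  have := Measure.addHaar_submodule (volume : Measure (E N)) S hS
  rw [ae_iff]
  convert this using 2
  ext x
  simp [S]

/-- The signs of the two components of a one-dimensional segregated profile. -/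
def sgn (i : Fin 2) : ℝ := if i = 0 then 1 else -1

@[simp] theorem sgn_zero : sgn 0 = 1 := rfl

@[simp] theorem sgn_one : sgn 1 = -1 := rfl

theorem sgn_mul_self (i : Fin 2) : sgn i * sgn i = 1 := by
  fin_cases i <;> simp

theorem abs_sgn (i : Fin 2) : |sgn i| = 1 := by
  fin_cases i <;> simp

theorem sgn_ne_zero (i : Fin 2) : sgn i ≠ 0 := by
  fin_cases i <;> simp

/-- The segregated pair `(a x_k⁺, a x_k⁻)`. -/
def ramp (a : ℝ) (k : Fin N) (i : Fin 2) (x : E N) : ℝ := a * max (sgn i * x k) 0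

theorem hasGradientAt_ramp (a : ℝ) (k : Fin N) (i : Fin 2) {x : E N} (hx : x k ≠ 0) :
    HasGradientAt (ramp a k i)
      ((if 0 < sgn i * x k then a * sgn i else 0) • EuclideanSpace.single k (1 : ℝ)) x := by
  refine hasGradientAt_comp_coord (g := fun t => a * max (sgn i * t) 0) ?_
  have hd : HasDerivAt (fun t => sgn i * t) (sgn i) (x k) := by
    simpa using (hasDerivAt_id (x k)).const_mul (sgn i)
  split_ifs with h
  · refine (hd.const_mul a).congr_of_eventuallyEq ?_
    filter_upwards [hd.continuousAt.eventually (lt_mem_nhds h)] with t ht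
    rw [max_eq_left ht.le]
  · have h' : sgn i * x k < 0 := lt_of_le_of_ne (not_lt.1 h) (mul_ne_zero (sgn_ne_zero i) hx)
    refine (hasDerivAt_const (x k) (0 : ℝ)).congr_of_eventuallyEq ?_
    filter_upwards [hd.continuousAt.eventually (gt_mem_nhds h')] with t ht
    rw [max_eq_right ht.le, mul_zero]

theorem sum_ramp_sq (a : ℝ) (k : Fin N) (x : E N) : ∑ i, ramp a k i x ^ 2 = a ^ 2 * x k ^ 2 := by
  simp only [ramp, Fin.sum_univ_two, sgn_zero, sgn_one]
  rcases le_total 0 (x k) with h | h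
  · rw [max_eq_left (by linarith), max_eq_right (by linarith)]; ring
  · rw [max_eq_right (by linarith), max_eq_left (by linarith)]; ring

theorem sum_norm_gradient_ramp_sq (a : ℝ) (k : Fin N) {x : E N} (hx : x k ≠ 0) :
    ∑ i, ‖gradient (ramp a k i) x‖ ^ 2 = a ^ 2 := by
  rw [Fin.sum_univ_two, (hasGradientAt_ramp a k 0 hx).gradient, (hasGradientAt_ramp a k 1 hx).gradient]
  rcases hx.lt_or_gt with h | h
  · simp [norm_smul, h, h.le]
  · simp [norm_smul, h, h.le]

/-- The profile is homogeneous of degree one. Since `∑ |∇uᵢ|² = a²` almost everywhere and `∑ uᵢ² =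
a² x_k²`, the quotient is exactly `1` at every radius. -/
theorem almgren_ramp {a : ℝ} (ha : a ≠ 0) (k : Fin N) {r : ℝ} (hr : 0 < r) :
    almgren (fun _ _ _ => 0) (ramp a k) 0 r = 1 := by
  have hN : 0 < N := k.pos
  set vb := volume.real (Metric.ball (0 : E N) 1)
  have hvb : 0 < vb := by
    refine ENNReal.toReal_pos (Metric.measure_ball_pos _ _ one_pos).ne' measure_ball_lt_top.ne
  have hnum : ∫ x in Metric.ball (0 : E N) r,
      ∑ i, (‖gradient (ramp a k i) x‖ ^ 2 - 0 * ramp a k i x) = r ^ N * vb * a ^ 2 := by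
    have : ∀ᵐ x ∂(volume.restrict (Metric.ball (0 : E N) r)),
        ∑ i, (‖gradient (ramp a k i) x‖ ^ 2 - 0 * ramp a k i x) = a ^ 2 := by
      filter_upwards [ae_restrict_of_ae (ae_coord_ne_zero k)] with x hx
      simpa using sum_norm_gradient_ramp_sq a k hx
    rw [integral_congr_ae this]
    have hball : volume.real (Metric.ball (0 : E N) r) = r ^ N * vb := by
      rw [Measure.real, Measure.addHaar_ball_of_pos _ _ hr, ENNReal.toReal_mul,
        ENNReal.toReal_ofReal (by positivity), finrank_euclideanSpace_fin]
      rfl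
    simp [hball]
  have hden : sphereIntegral (fun x => ∑ i, ramp a k i x ^ 2) (0 : E N) r =
      r ^ (N - 1) * (a ^ 2 * r ^ 2 * vb) := by
    simp only [sphereIntegral, sum_ramp_sq]
    have hθ : ∀ θ : Metric.sphere (0 : E N) 1,
        a ^ 2 * (0 + r • (θ : E N)) k ^ 2 = a ^ 2 * r ^ 2 * (θ : E N) k ^ 2 := by
      intro θ
      simp
      ring
    simp only [hθ]
    rw [integral_const_mul, integral_toSphere_coord_sq k]
  rw [almgren, hnum, hden]
  -- Removes the natural subtraction in `r ^ (N - 1)`.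
  obtain ⟨n, rfl⟩ : ∃ n, N = n + 1 := ⟨N - 1, by omega⟩
  rw [Nat.add_sub_cancel]
  field_simp
  ring

end Competition

/-! ### Tools for the convergences and for integration by parts. -/

/-- Bounded convergence theorem in `L²` of a finite measure. -/
theorem tendsto_eLpNorm_two_of_bounded {X Y : Type*} [MeasurableSpace X] [NormedAddCommGroup Y]
    {μ : Measure X} [IsFiniteMeasure μ] {F : ℕ → X → Y} {C : ℝ}
    (hm : ∀ n, AEStronglyMeasurable (F n) μ) (hb : ∀ n, ∀ᵐ x ∂μ, ‖F n x‖ ≤ C)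
    (hlim : ∀ᵐ x ∂μ, Tendsto (fun n => F n x) atTop (𝓝 0)) :
    Tendsto (fun n => eLpNorm (F n) 2 μ) atTop (𝓝 0) := by
  have h1 : Tendsto (fun n => ∫⁻ x, ‖F n x‖ₑ ^ (2 : ℝ) ∂μ) atTop (𝓝 (∫⁻ _, 0 ∂μ)) := by
    refine tendsto_lintegral_of_dominated_convergence' (fun _ => ENNReal.ofReal C ^ (2 : ℝ))
      (fun n => (hm n).enorm.pow_const _) (fun n => ?_) ?_ ?_
    · filter_upwards [hb n] with x hx
      gcongr
      rw [← ofReal_norm]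
      exact ENNReal.ofReal_le_ofReal hx
    · rw [lintegral_const]
      exact ENNReal.mul_ne_top (ENNReal.rpow_ne_top_of_nonneg (by norm_num) ENNReal.ofReal_ne_top)
        (measure_ne_top _ _)
    · filter_upwards [hlim] with x hx
      have := (ENNReal.continuous_rpow_const (y := 2)).tendsto _ |>.comp hx.enorm
      simpa using! this
  rw [lintegral_zero] at h1
  have h2 := ((ENNReal.continuous_rpow_const (y := 1 / 2)).tendsto 0).comp h1
  rw [ENNReal.zero_rpow_of_pos (by norm_num)] at h2
  refine h2.congr fun n => ?_
  rw [eLpNorm_eq_lintegral_rpow_enorm_toReal two_ne_zero ENNReal.ofNat_ne_top]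
  simp

/-- Interpolation: a small supremum bound `p` and a Lipschitz bound `q` combine to a small Hölder
bound. -/
theorem le_rpow_mul_rpow_of_le {z p q α : ℝ} (hz : 0 ≤ z) (hp : z ≤ p) (hq : z ≤ q) (h0 : 0 < α)
    (h1 : α < 1) : z ≤ p ^ (1 - α) * q ^ α := by
  calc z = z ^ (1 - α) * z ^ α := by
        rw [← Real.rpow_add' hz (by norm_num), sub_add_cancel, Real.rpow_one]
    _ ≤ p ^ (1 - α) * q ^ α := by
        have := hz.trans hp
        gcongr

/-- The product of a function continuous on an open set and a function with compact support in it
is integrable. -/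
theorem integrable_mul_of_continuousOn {X : Type*} [TopologicalSpace X] [T2Space X]
    [MeasurableSpace X] [BorelSpace X] {μ : Measure X} [IsFiniteMeasureOnCompacts μ]
    {F ψ : X → ℝ} {K Ω : Set X} (hF : ContinuousOn F Ω) (hψ : Continuous ψ) (hK : IsCompact K)
    (hKΩ : K ⊆ Ω) (hψK : ∀ x, x ∉ K → ψ x = 0) : Integrable (fun x => F x * ψ x) μ := by
  have h1 : IntegrableOn (fun x => F x * ψ x) K μ :=
    ((hF.mono hKΩ).mul hψ.continuousOn).integrableOn_compact hK
  refine (integrableOn_iff_integrable_of_support_subset fun x hx => ?_).1 h1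
  by_contra hxK
  exact hx (by simp [hψK x hxK])

theorem IsProfile.contDiffOn {T A : ℝ} {U P : ℝ → ℝ} (H : IsProfile T A U P) :
    ContDiffOn ℝ 1 U (Ioo (-T) T) := by
  rw [show (1 : WithTop ℕ∞) = 0 + 1 from rfl, contDiffOn_succ_iff_deriv_of_isOpen isOpen_Ioo]
  refine ⟨fun t ht => (H.hU t ht).differentiableAt.differentiableWithinAt, by simp, ?_⟩
  rw [contDiffOn_zero]
  refine ContinuousOn.congr (f := P) (fun t ht => (H.hP t ht).continuousAt.continuousWithinAt) ?_
  exact fun t ht => (H.hU t ht).deriv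

/-! ### Rescaled profiles as solutions in a slab. -/

namespace Competition

variable {N : ℕ}

/-- The slab `|x_k| < 1`. -/
def slab (k : Fin N) : Set (E N) := {x | |x k| < 1}

theorem isOpen_slab (k : Fin N) : IsOpen (slab k) :=
  isOpen_lt (by fun_prop) continuous_const

theorem convex_slab (k : Fin N) : Convex ℝ (slab k) := by
  have : slab k = (EuclideanSpace.proj k : E N →L[ℝ] ℝ).toLinearMap ⁻¹' Ioo (-1) 1 := by
    ext x
    simp [slab, abs_lt]
  rw [this]
  exact (convex_Ioo (-1 : ℝ) 1).linear_preimage _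

theorem zero_mem_slab (k : Fin N) : (0 : E N) ∈ slab k := by simp [slab]

/-- The pair `(U(m x_k) / m, U(-m x_k) / m)`. -/
noncomputable def rescaled (m : ℝ) (U : ℝ → ℝ) (k : Fin N) (i : Fin 2) (x : E N) : ℝ := U (sgn i * m * x k) / m

section

variable {m A : ℝ} {U P : ℝ → ℝ} {k : Fin N}

theorem mul_mem_Ioo_of_mem_slab (hm : 0 < m) (i : Fin 2) {x : E N} (hx : x ∈ slab k) :
    sgn i * m * x k ∈ Ioo (-m) m := by
  rw [mem_Ioo, ← abs_lt, abs_mul, abs_mul, abs_sgn, abs_of_pos hm]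
  have : |x k| < 1 := hx
  nlinarith

theorem hasGradientAt_rescaled (H : IsProfile m A U P) (hm : 0 < m) (i : Fin 2) {x : E N}
    (hx : x ∈ slab k) :
    HasGradientAt (rescaled m U k i)
      ((sgn i * P (sgn i * m * x k)) • EuclideanSpace.single k (1 : ℝ)) x := by
  refine hasGradientAt_comp_coord (g := fun t => U (sgn i * m * t) / m) ?_
  have hd : HasDerivAt (fun t => sgn i * m * t) (sgn i * m) (x k) := by
    simpa using (hasDerivAt_id (x k)).const_mul (sgn i * m)
  refine (((H.hU _ (mul_mem_Ioo_of_mem_slab hm i hx)).comp (x k) hd).div_const m).congr_deriv ?_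
  field_simp

theorem contDiffOn_rescaled (H : IsProfile m A U P) (hm : 0 < m) (i : Fin 2) :
    ContDiffOn ℝ 1 (rescaled m U k i) (slab k) := by
  have h1 : ContDiff ℝ 1 fun x : E N => sgn i * m * x k := by fun_prop
  exact (H.contDiffOn.comp h1.contDiffOn fun x hx => mul_mem_Ioo_of_mem_slab hm i hx).div_const m

theorem rescaled_pos (H : IsProfile m A U P) (hm : 0 < m) (i : Fin 2) {x : E N}
    (hx : x ∈ slab k) : 0 < rescaled m U k i x :=
  div_pos (H.pos _ (mul_mem_Ioo_of_mem_slab hm i hx)) hm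

theorem norm_gradient_rescaled_le (H : IsProfile m A U P) (hm : 0 < m) (i : Fin 2) {x : E N}
    (hx : x ∈ slab k) : ‖gradient (rescaled m U k i) x‖ ≤ 2 := by
  rw [(hasGradientAt_rescaled H hm i hx).gradient, norm_smul, norm_mul, Real.norm_eq_abs,
    Real.norm_eq_abs, abs_sgn]
  simpa using H.abs_P_le _ (mul_mem_Ioo_of_mem_slab hm i hx)

theorem abs_rescaled_sub_le (H : IsProfile m A U P) (hm : 0 < m) (i : Fin 2) {x y : E N}
    (hx : x ∈ slab k) (hy : y ∈ slab k) :
    |rescaled m U k i x - rescaled m U k i y| ≤ 2 * ‖x - y‖ := by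
  refine (convex_slab k).norm_image_sub_le_of_norm_fderiv_le (𝕜 := ℝ) (fun z hz =>
    (hasGradientAt_rescaled H hm i hz).differentiableAt) (fun z hz => ?_) hy hx
  rw [← toDual_gradient, LinearIsometryEquiv.norm_map]
  exact norm_gradient_rescaled_le H hm i hz

/-- The bounded distance `5` between profile and ramp shrinks to `5 / m` under rescaling. The rest
is the error in the slope, with `|x_k| < 1`. -/
theorem abs_rescaled_sub_ramp_le (H : IsProfile m A U P) (hm : 0 < m) (a : ℝ) (i : Fin 2) {x : E N}
    (hx : x ∈ slab k) : |rescaled m U k i x - ramp a k i x| ≤ 5 / m + |A - a| := by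
  have h1 := H.abs_U_sub_le _ (mul_mem_Ioo_of_mem_slab hm i hx)
  have h2 : rescaled m U k i x - ramp A k i x =
      (U (sgn i * m * x k) - A * max (sgn i * m * x k) 0) / m := by
    have : max (sgn i * m * x k) 0 = m * max (sgn i * x k) 0 := by
      rw [mul_max_of_nonneg _ _ hm.le]
      congr 1 <;> ring
    rw [rescaled, ramp, this]
    field_simp
  have h3 : |rescaled m U k i x - ramp A k i x| ≤ 5 / m := by
    rw [h2, abs_div, abs_of_pos hm]
    gcongr
  have h4 : |ramp A k i x - ramp a k i x| ≤ |A - a| := by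
    have h5 : ramp A k i x - ramp a k i x = (A - a) * max (sgn i * x k) 0 := by
      rw [ramp, ramp]; ring
    have h6 : max (sgn i * x k) 0 ≤ 1 := by
      refine max_le ((le_abs_self _).trans ?_) zero_le_one
      rw [abs_mul, abs_sgn, one_mul]
      exact (show |x k| < 1 from hx).le
    rw [h5, abs_mul, abs_of_nonneg (le_max_right (sgn i * x k) 0)]
    exact mul_le_of_le_one_right (abs_nonneg _) h6
  calc _ ≤ _ := abs_sub_le _ (ramp A k i x) _
    _ ≤ _ := add_le_add h3 h4

/-- With `u = U(m x_k) / m` and `v = U(-m x_k) / m`, two derivatives give `m U V²`, and `U V² = m³ u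
v²`; hence `β = m⁴`. -/
theorem isPositiveWeakSolution_rescaled (H : IsProfile m A U P) (hm : 0 < m) :
    IsPositiveWeakSolution (slab k) (fun _ _ => 1) (m ^ 4) (fun _ _ _ => 0) (rescaled m U k) where
  contDiffOn := contDiffOn_rescaled H hm
  pos i x hx := rescaled_pos H hm i hx
  weak_eq i φ hφ hφc hφΩ := by
    set e : E N := EuclideanSpace.single k (1 : ℝ)
    -- `G` is the `k`-th partial derivative of the component and `D` that of `G`. As gradients are
    -- parallel to `e`, the weak equation is a single integration by parts in this direction.
    set G : E N → ℝ := fun x => sgn i * P (sgn i * m * x k)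
    set D : E N → ℝ := fun x => m * (U (sgn i * m * x k) * U (-(sgn i * m * x k)) ^ 2)
    have hGd : ∀ x ∈ slab k, HasGradientAt G (D x • e) x := by
      intro x hx
      refine hasGradientAt_comp_coord (g := fun t => sgn i * P (sgn i * m * t)) ?_
      have hd : HasDerivAt (fun t => sgn i * m * t) (sgn i * m) (x k) := by
        simpa using (hasDerivAt_id (x k)).const_mul (sgn i * m)
      refine (((H.hP _ (mul_mem_Ioo_of_mem_slab hm i hx)).comp (x k) hd).const_mul
        (sgn i)).congr_deriv ?_
      simp only [D]
      linear_combination (m * (U (sgn i * m * x k) * U (-(sgn i * m * x k)) ^ 2)) * sgn_mul_self i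
    have hee : inner ℝ e e = (1 : ℝ) := by simp [e]
    have hGe : ∀ x ∈ slab k, fderiv ℝ G x e = D x := by
      intro x hx
      rw [(hGd x hx).fderiv_apply, inner_smul_left, hee]
      simp
    have hUc : ∀ j, ContinuousOn (fun x : E N => U (sgn j * m * x k)) (slab k) := fun j =>
      H.contDiffOn.continuousOn.comp (by fun_prop) fun x hx => mul_mem_Ioo_of_mem_slab hm j hx
    have hDc : ContinuousOn D (slab k) := by
      have hneg : ContinuousOn (fun x : E N => U (-(sgn i * m * x k))) (slab k) := by
        refine H.contDiffOn.continuousOn.comp (by fun_prop) fun x hx => ?_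
        have := mul_mem_Ioo_of_mem_slab hm i hx
        exact ⟨by linarith [this.2], by linarith [this.1]⟩
      exact continuousOn_const.mul ((hUc i).mul (hneg.pow 2))
    have hGc : ContinuousOn G (slab k) := fun x hx => (hGd x hx).continuousAt.continuousWithinAt
    have hφ0 : ∀ x, x ∉ tsupport φ → φ x = 0 := fun x hx => image_eq_zero_of_notMem_tsupport hx
    have hφ1 : ∀ x, x ∉ tsupport φ → fderiv ℝ φ x = 0 := fun x hx =>
      image_eq_zero_of_notMem_tsupport fun h => hx (tsupport_fderiv_subset ℝ h)
    have hφ2 : ∀ x, x ∉ tsupport φ → fderiv ℝ φ x e = 0 := fun x hx => by simp [hφ1 x hx]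
    have hdφ : Continuous fun x => fderiv ℝ φ x e :=
      (hφ.continuous_fderiv (by simp)).clm_apply continuous_const
    have hφΩ' : ∀ x, x ∉ slab k → x ∉ tsupport φ := fun x hx h => hx (hφΩ h)
    have hmul : ∀ x, fderiv ℝ G x e * φ x = D x * φ x := by
      intro x
      by_cases hx : x ∈ tsupport φ
      · rw [hGe x (hφΩ hx)]
      · simp [hφ0 x hx]
    have hibp := integral_mul_fderiv_eq_neg_fderiv_mul_of_integrable (μ := volume)
      (f := G) (g := φ) (v := e)
      (by
        simp only [hmul]
        exact integrable_mul_of_continuousOn hDc hφ.continuous hφc hφΩ hφ0)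
      (integrable_mul_of_continuousOn hGc hdφ hφc hφΩ hφ2)
      (integrable_mul_of_continuousOn hGc hφ.continuous hφc hφΩ hφ0)
      (fun x hx => (hGd x (hφΩ hx)).differentiableAt)
      (fun x _ => hφ.differentiable (by simp) x)
    simp only [hmul] at hibp
    have hleft : ∫ x in slab k, inner ℝ (gradient (rescaled m U k i) x) (gradient φ x) =
        ∫ x, G x * fderiv ℝ φ x e := by
      -- The test function is supported in the slab, so integrals may be taken over the whole space.
      rw [← setIntegral_eq_integral_of_forall_compl_eq_zero (s := slab k)
        (f := fun x => G x * fderiv ℝ φ x e) fun x hx => by rw [hφ2 x (hφΩ' x hx), mul_zero]]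
      refine setIntegral_congr_fun (isOpen_slab k).measurableSet fun x hx => ?_
      simp only [(hasGradientAt_rescaled H hm i hx).gradient,
        inner_gradient_right]
      simp [G, e]
    rw [hleft, hibp, ← integral_neg, ← setIntegral_eq_integral_of_forall_compl_eq_zero (s := slab k)
        fun x hx => by rw [hφ0 x (hφΩ' x hx), mul_zero, neg_zero]]
    refine setIntegral_congr_fun (isOpen_slab k).measurableSet fun x _ => ?_
    have hsum : ∑ j ∈ Finset.univ.erase i, (1 : ℝ) * rescaled m U k j x ^ 2 =
        (U (-(sgn i * m * x k)) / m) ^ 2 := by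
      fin_cases i
      · rw [show Finset.univ.erase ((fun i => i) ⟨0, by norm_num⟩ : Fin 2) = {1} by decide]
        simp [rescaled]
      · rw [show Finset.univ.erase ((fun i => i) ⟨1, by norm_num⟩ : Fin 2) = {0} by decide]
        simp [rescaled]
    rw [hsum]
    simp only [rescaled, D]
    field_simp
    ring

end

theorem lipschitzWith_ramp {a : ℝ} (ha : 0 ≤ a) (k : Fin N) (i : Fin 2) :
    LipschitzWith a.toNNReal (ramp a k i) := by
  refine LipschitzWith.of_dist_le_mul fun x y => ?_
  rw [Real.coe_toNNReal _ ha, Real.dist_eq, ramp, ramp, ← mul_sub, abs_mul, abs_of_nonneg ha]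
  gcongr
  refine (abs_max_sub_max_le_abs _ _ _).trans ?_
  rw [← mul_sub, abs_mul, abs_sgn, one_mul, dist_eq_norm]
  exact PiLp.norm_apply_le (x - y) k

end Competition

/-! ### Convergence of the rescaled profiles to the segregated pair. -/

namespace Competition

variable {N : ℕ} {m A : ℕ → ℝ} {a : ℝ} {U P : ℕ → ℝ → ℝ}

/-- Off the hyperplane `x_k = 0` the rescaled argument tends to `±∞`, where `P` approaches `A` like
`1/t²` on the right and `0` like `1/|t|` on the left. -/
theorem tendsto_gradient_rescaled (H : ∀ n, IsProfile (m n) (A n) (U n) (P n))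
    (hm : ∀ n, 1 ≤ m n) (hmt : Tendsto m atTop atTop) (hA : Tendsto A atTop (𝓝 a)) (k : Fin N)
    (i : Fin 2) {x : E N} (hx : x ∈ slab k) (hxk : x k ≠ 0) :
    Tendsto (fun n => gradient (rescaled (m n) (U n) k i) x - gradient (ramp a k i) x) atTop
      (𝓝 0) := by
  have hm0 : ∀ n, 0 < m n := fun n => one_pos.trans_le (hm n)
  have hinv : Tendsto (fun n => (m n)⁻¹) atTop (𝓝 0) := tendsto_inv_atTop_zero.comp hmt
  have hP : Tendsto (fun n => P n (sgn i * m n * x k)) atTop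
      (𝓝 (if 0 < sgn i * x k then a else 0)) := by
    set s := sgn i * x k with hs
    have hst : ∀ n, sgn i * m n * x k = m n * s := fun n => by rw [hs]; ring
    have hs0 : s ≠ 0 := mul_ne_zero (sgn_ne_zero i) hxk
    have hmem : ∀ n, m n * s ∈ Ioo (-m n) (m n) := fun n =>
      hst n ▸ mul_mem_Ioo_of_mem_slab (hm0 n) i hx
    simp only [hst]
    split_ifs with h
    · have h1 : Tendsto (fun n => P n (m n * s) - A n) atTop (𝓝 0) := by
        refine squeeze_zero_norm (a := fun n => 4 / s ^ 2 * (m n)⁻¹) (fun n => ?_)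
          (by simpa using hinv.const_mul (4 / s ^ 2))
        have h2 := (H n).abs_P_sub_le (m n * s) ⟨mul_pos (hm0 n) h, (hmem n).2⟩
        have h3 := hm n
        have h4 := hm0 n
        rw [Real.norm_eq_abs, ← div_eq_mul_inv, div_div, le_div_iff₀ (by positivity)]
        refine le_trans ?_ h2
        have : s ^ 2 * m n ≤ (m n * s) ^ 2 := by
          nlinarith [mul_nonneg (sq_nonneg s) (mul_nonneg h4.le (sub_nonneg.2 h3))]
        gcongr
      simpa using h1.add hA
    · have hneg : s < 0 := lt_of_le_of_ne (not_lt.1 h) hs0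
      refine squeeze_zero_norm (a := fun n => 2 / |s| * (m n)⁻¹) (fun n => ?_)
          (by simpa using hinv.const_mul (2 / |s|))
      have h2 := (H n).abs_P_mul_le (m n * s) ⟨(hmem n).1, mul_neg_of_pos_of_neg (hm0 n) hneg⟩
      have h4 := hm0 n
      have h5 : 0 < |s| := abs_pos.2 hs0
      rw [Real.norm_eq_abs, ← div_eq_mul_inv, div_div, le_div_iff₀ (by positivity)]
      rwa [abs_mul, abs_of_pos h4, mul_comm (m n) |s|] at h2
  have hlim := ((hP.const_mul (sgn i)).smul_const (EuclideanSpace.single k (1 : ℝ))).sub_const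
    (gradient (ramp a k i) x)
  have hz : (sgn i * if 0 < sgn i * x k then a else 0) • EuclideanSpace.single k (1 : ℝ)
      - gradient (ramp a k i) x = 0 := by
    rw [(hasGradientAt_ramp a k i hxk).gradient, sub_eq_zero]
    congr 1
    split_ifs <;> ring
  rw [hz] at hlim
  refine hlim.congr fun n => ?_
  rw [(hasGradientAt_rescaled (H n) (hm0 n) i hx).gradient]

theorem tendsto_rescaled_bound (hmt : Tendsto m atTop atTop) (hA : Tendsto A atTop (𝓝 a)) :
    Tendsto (fun n => 5 / m n + |A n - a|) atTop (𝓝 0) := by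
  have h1 : Tendsto (fun n => 5 / m n) atTop (𝓝 0) := tendsto_const_nhds.div_atTop hmt
  have h2 : Tendsto (fun n => |A n - a|) atTop (𝓝 0) := by
    simpa using (hA.sub_const a).abs
  simpa using h1.add h2

theorem tendstoHolderLoc_rescaled (H : ∀ n, IsProfile (m n) (A n) (U n) (P n))
    (hm : ∀ n, 1 ≤ m n) (hmt : Tendsto m atTop atTop) (hA : Tendsto A atTop (𝓝 a)) (ha : 0 ≤ a)
    (k : Fin N) (i : Fin 2) {α : ℝ} (hα : α ∈ Ioo (0 : ℝ) 1) :
    TendstoHolderLoc (slab k) α (fun n => rescaled (m n) (U n) k i) (ramp a k i) := by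
  intro K _ hKΩ ε hε
  have hm0 : ∀ n, 0 < m n := fun n => one_pos.trans_le (hm n)
  have hδ := tendsto_rescaled_bound hmt hA
  have hδ2 : Tendsto (fun n => (2 * (5 / m n + |A n - a|)) ^ (1 - α) * (2 + a) ^ α) atTop
      (𝓝 0) := by
    have := ((hδ.const_mul 2).rpow_const (p := 1 - α) (Or.inr (by linarith [hα.2]))).mul_const
      ((2 + a) ^ α)
    simpa [Real.zero_rpow (by linarith [hα.2] : 1 - α ≠ 0)] using this
  filter_upwards [hδ.eventually (gt_mem_nhds hε), hδ2.eventually (gt_mem_nhds hε)] with n h1 h2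
  have hb : ∀ x ∈ K, |rescaled (m n) (U n) k i x - ramp a k i x| ≤ 5 / m n + |A n - a| :=
    fun x hx => abs_rescaled_sub_ramp_le (H n) (hm0 n) a i (hKΩ hx)
  refine ⟨fun x hx => (hb x hx).trans h1.le, fun x hx y hy => ?_⟩
  have hp : |(rescaled (m n) (U n) k i x - ramp a k i x)
      - (rescaled (m n) (U n) k i y - ramp a k i y)| ≤ 2 * (5 / m n + |A n - a|) := by
    refine (abs_sub _ _).trans ?_
    linarith [hb x hx, hb y hy]
  -- The gradients are bounded by `2` and the limit is `a`-Lipschitz, so the differences have a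
  -- Lipschitz constant independent of `n`.
  have hq : |(rescaled (m n) (U n) k i x - ramp a k i x)
      - (rescaled (m n) (U n) k i y - ramp a k i y)| ≤ (2 + a) * ‖x - y‖ := by
    have h3 := abs_rescaled_sub_le (H n) (hm0 n) i (hKΩ hx) (hKΩ hy)
    have h4 := (lipschitzWith_ramp ha k i).dist_le_mul x y
    rw [Real.coe_toNNReal _ ha, Real.dist_eq, dist_eq_norm] at h4
    rw [sub_sub_sub_comm]
    refine (abs_sub _ _).trans ?_
    linarith
  refine (le_rpow_mul_rpow_of_le (abs_nonneg _) hp hq hα.1 hα.2).trans ?_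
  rw [Real.mul_rpow (by positivity) (norm_nonneg _), ← mul_assoc]
  gcongr

theorem tendstoH1Loc_rescaled (H : ∀ n, IsProfile (m n) (A n) (U n) (P n))
    (hm : ∀ n, 1 ≤ m n) (hmt : Tendsto m atTop atTop) (hA : Tendsto A atTop (𝓝 a)) (ha : 0 ≤ a)
    (k : Fin N) (i : Fin 2) :
    TendstoH1Loc (slab k) (fun n => rescaled (m n) (U n) k i) (ramp a k i) := by
  intro K hK hKΩ
  have hm0 : ∀ n, 0 < m n := fun n => one_pos.trans_le (hm n)
  have hδ := tendsto_rescaled_bound hmt hA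
  have hfin : IsFiniteMeasure (volume.restrict K) := ⟨by simpa using hK.measure_lt_top⟩
  have hKm : ∀ᵐ x ∂(volume.restrict K), x ∈ K := ae_restrict_mem hK.measurableSet
  obtain ⟨B, hB⟩ := hδ.bddAbove_range
  have hb : ∀ n, ∀ x ∈ K, ‖rescaled (m n) (U n) k i x - ramp a k i x‖ ≤ 5 / m n + |A n - a| :=
    fun n x hx => abs_rescaled_sub_ramp_le (H n) (hm0 n) a i (hKΩ hx)
  have hgm : ∀ w : E N → ℝ, Measurable (gradient w) := fun w =>
    ((InnerProductSpace.toDual ℝ (E N)).symm.continuous.measurable).comp (measurable_fderiv ℝ w)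
  constructor
  · refine tendsto_eLpNorm_two_of_bounded (C := B) (fun n => ?_) (fun n => ?_) ?_
    · exact ((((contDiffOn_rescaled (H n) (hm0 n) i).continuousOn.mono hKΩ).sub
        (lipschitzWith_ramp ha k i).continuous.continuousOn)).aestronglyMeasurable hK.measurableSet
    · filter_upwards [hKm] with x hx
      exact (hb n x hx).trans (hB ⟨n, rfl⟩)
    · filter_upwards [hKm] with x hx
      exact squeeze_zero_norm (fun n => hb n x hx) hδ
  · have hne : ∀ᵐ x ∂(volume.restrict K), x k ≠ 0 := ae_restrict_of_ae (ae_coord_ne_zero k)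
    refine tendsto_eLpNorm_two_of_bounded (C := 2 + a) (fun n => ?_) (fun n => ?_) ?_
    · exact ((hgm _).sub (hgm _)).aestronglyMeasurable
    · filter_upwards [hKm, hne] with x hx hxk
      refine (norm_sub_le _ _).trans (add_le_add
        (norm_gradient_rescaled_le (H n) (hm0 n) i (hKΩ hx)) ?_)
      rw [(hasGradientAt_ramp a k i hxk).gradient, norm_smul, Real.norm_eq_abs]
      split_ifs
      · simp [abs_mul, abs_sgn, abs_of_nonneg ha]
      · simpa using ha
    · filter_upwards [hKm, hne] with x hx hxk
      exact tendsto_gradient_rescaled H hm hmt hA k i (hKΩ hx) hxk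

theorem isSegregatingSequence_rescaled (H : ∀ n, IsProfile (m n) (A n) (U n) (P n))
    (hm : ∀ n, 1 ≤ m n) (hmt : Tendsto m atTop atTop) (hA : Tendsto A atTop (𝓝 a)) (ha : 0 ≤ a)
    (k : Fin N) :
    IsSegregatingSequence (slab k) (fun _ _ : Fin 2 => (1 : ℝ)) (fun n => m n ^ 4)
      (fun _ _ _ _ => 0) (fun _ _ _ => 0) (fun n => rescaled (m n) (U n) k) (ramp a k) where
  isOpen := isOpen_slab k
  isConnected := ((convex_slab k).isPathConnected ⟨0, zero_mem_slab k⟩).isConnected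
  symm _ _ := rfl
  coupling_pos _ _ _ := one_pos
  beta_pos n := pow_pos (one_pos.trans_le (hm n)) 4
  beta_tendsto := (tendsto_pow_atTop (by norm_num)).comp hmt
  contDiffOn_approx _ _ := contDiffOn_const
  contDiffOn_limit _ := contDiffOn_const
  linear_bound := ⟨0, fun _ _ _ _ _ _ => by simp⟩
  nonlinearity_tendsto _ := fun _ hu _ _ =>
    ⟨univ, univ_mem, .of_forall fun _ _ _ => refl_mem_uniformity hu⟩
  solution n := isPositiveWeakSolution_rescaled (H n) (one_pos.trans_le (hm n))
  bounded := by
    obtain ⟨B, hB⟩ := (tendsto_rescaled_bound hmt hA).bddAbove_range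
    refine ⟨B + a, fun n i x hx => ?_⟩
    have h1 := abs_rescaled_sub_ramp_le (H n) (one_pos.trans_le (hm n)) a i hx
    have h2 : 5 / m n + |A n - a| ≤ B := hB ⟨n, rfl⟩
    have h3 : |ramp a k i x| ≤ a := by
      have h6 : max (sgn i * x k) 0 ≤ 1 := by
        refine max_le ((le_abs_self _).trans ?_) zero_le_one
        rw [abs_mul, abs_sgn, one_mul]
        exact (show |x k| < 1 from hx).le
      rw [ramp, abs_mul, abs_of_nonneg ha, abs_of_nonneg (le_max_right (sgn i * x k) 0)]
      exact mul_le_of_le_one_right ha h6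
    have h4 := abs_add_le (rescaled (m n) (U n) k i x - ramp a k i x) (ramp a k i x)
    rw [sub_add_cancel] at h4
    linarith
  limit_lipschitz i := (lipschitzWith_ramp ha k i).locallyLipschitz.locallyLipschitzOn
  tendsto_holder i _ hα := tendstoHolderLoc_rescaled H hm hmt hA ha k i hα
  tendsto_h1 i := tendstoH1Loc_rescaled H hm hmt hA ha k i

/-- Each component contributes `P(0) = 1`, whatever `m` is; the scaling preserves slopes. -/
theorem hasGradientAt_rescaled_sub {m A : ℝ} {U P : ℝ → ℝ} (H : IsProfile m A U P) (hm : 0 < m)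
    (k : Fin N) : HasGradientAt (fun y : E N => rescaled m U k 0 y - rescaled m U k 1 y)
      ((2 : ℝ) • EuclideanSpace.single k (1 : ℝ)) 0 := by
  have h0 := (hasGradientAt_rescaled H hm 0 (zero_mem_slab k)).hasFDerivAt
  have h1 := (hasGradientAt_rescaled H hm 1 (zero_mem_slab k)).hasFDerivAt
  rw [hasGradientAt_iff_hasFDerivAt]
  refine (h0.sub h1).congr_fderiv ?_
  rw [← map_sub, ← sub_smul]
  congr 2
  simp [H.P_zero]
  norm_num

theorem hasGradientAt_ramp_sub (a : ℝ) (k : Fin N) :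
    HasGradientAt (fun y : E N => ramp a k 0 y - ramp a k 1 y)
      (a • EuclideanSpace.single k (1 : ℝ)) 0 := by
  have h : (fun y : E N => ramp a k 0 y - ramp a k 1 y) = fun y => a * y k := by
    ext y
    simp only [ramp, sgn_zero, sgn_one]
    rcases le_total 0 (y k) with h | h
    · rw [max_eq_left (by linarith), max_eq_right (by linarith)]; ring
    · rw [max_eq_right (by linarith), max_eq_left (by linarith)]; ring
  rw [h]
  refine hasGradientAt_comp_coord (g := fun t => a * t) ?_
  simpa using (hasDerivAt_id ((0 : E N) k)).const_mul a

end Competition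

/-! ### Assembly of the two statements. -/

theorem proposition1p14 (N : ℕ) (hN : 1 ≤ N) (hN4 : N ≤ 4) :
    -- the gradients do not converge in general
    (∃ (Ω : Set (Competition.E N)) (a : Fin 2 → Fin 2 → ℝ) (β : ℕ → ℝ)
        (fβ : ℕ → Fin 2 → Competition.E N → ℝ → ℝ) (f : Fin 2 → Competition.E N → ℝ → ℝ)
        (uβ : ℕ → Fin 2 → Competition.E N → ℝ) (u : Fin 2 → Competition.E N → ℝ)
        (x : ℕ → Competition.E N) (x₀ L g : Competition.E N),
      Competition.IsSegregatingSequence Ω a β fβ f uβ u ∧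
      (∀ n, x n ∈ Competition.interface Ω (uβ n)) ∧
      x₀ ∈ Competition.regularPart Ω f u ∧
      Tendsto x atTop (𝓝 x₀) ∧
      HasGradientAt (fun y => u 0 y - u 1 y) g x₀ ∧
      Tendsto (fun n => gradient (fun y => uβ n 0 y - uβ n 1 y) (x n)) atTop (𝓝 L) ∧
      L ≠ g ∧
      ∀ α ∈ Ioo (0 : ℝ) 1, ∀ ρ > 0, Metric.ball x₀ ρ ⊆ Ω →
        ¬ Competition.BoundedC1Holder (Metric.ball x₀ ρ) α (fun n y => uβ n 0 y - uβ n 1 y)) ∧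
    -- whenever they do not converge, the differences are unbounded in `C^{1,α}`
    (∀ (Ω : Set (Competition.E N)) (a : Fin 2 → Fin 2 → ℝ) (β : ℕ → ℝ)
        (fβ : ℕ → Fin 2 → Competition.E N → ℝ → ℝ) (f : Fin 2 → Competition.E N → ℝ → ℝ)
        (uβ : ℕ → Fin 2 → Competition.E N → ℝ) (u : Fin 2 → Competition.E N → ℝ)
        (x : ℕ → Competition.E N) (x₀ : Competition.E N),
      Competition.IsSegregatingSequence Ω a β fβ f uβ u →
      (∀ n, x n ∈ Competition.interface Ω (uβ n)) →
      x₀ ∈ Competition.regularPart Ω f u →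
      Tendsto x atTop (𝓝 x₀) →
      ¬ Tendsto (fun n => gradient (fun y => uβ n 0 y - uβ n 1 y) (x n)) atTop
          (𝓝 (gradient (fun y => u 0 y - u 1 y) x₀)) →
      ∀ α ∈ Ioo (0 : ℝ) 1, ∀ ρ > 0, Metric.ball x₀ ρ ⊆ Ω →
        ¬ Competition.BoundedC1Holder (Metric.ball x₀ ρ) α
          (fun n y => uβ n 0 y - uβ n 1 y)) := by
  refine ⟨?_, ?_⟩
  · obtain ⟨m, A, a, U, P, hm, hmt, hA, ha1, ha2, H⟩ := exists_seq_isProfile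
    let k : Fin N := ⟨0, hN⟩
    have hm0 : ∀ n, 0 < m n := fun n => one_pos.trans_le (hm n)
    have ha0 : 0 ≤ a := by linarith
    have hseq := Competition.isSegregatingSequence_rescaled H hm hmt hA ha0 k
    -- The slopes differ because `a ≤ 3/2 < 2`, a consequence of the energy identity.
    have hne : (2 : ℝ) • EuclideanSpace.single k (1 : ℝ) ≠ a • EuclideanSpace.single k (1 : ℝ) := by
      intro h
      have := congrArg (fun v : Competition.E N => v k) h
      simp at this
      linarith
    have hgrad : Tendsto (fun n => gradient (fun y : Competition.E N =>
        Competition.rescaled (m n) (U n) k 0 y - Competition.rescaled (m n) (U n) k 1 y) 0) atTop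
        (𝓝 ((2 : ℝ) • EuclideanSpace.single k (1 : ℝ))) :=
      tendsto_const_nhds.congr fun n =>
        (Competition.hasGradientAt_rescaled_sub (H n) (hm0 n) k).gradient.symm
    have hgrad₀ := Competition.hasGradientAt_ramp_sub a k
    refine ⟨_, _, _, _, _, _, _, fun _ => 0, 0, _, _, hseq, fun n => ?_, ?_, tendsto_const_nhds,
      hgrad₀, hgrad, hne, fun α hα ρ hρ hball => ?_⟩
    -- At the origin both components equal `U(0) / m`.
    · refine ⟨Competition.zero_mem_slab k, 0, 1, by decide, ?_, fun l => ?_⟩ <;>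
        simp [Competition.rescaled]
    · refine ⟨⟨Competition.zero_mem_slab k, fun i => by simp [Competition.ramp]⟩, ?_⟩
      refine tendsto_const_nhds.congr' ?_
      filter_upwards [self_mem_nhdsWithin] with r hr
      exact (Competition.almgren_ramp (by linarith) k hr).symm
    · refine hseq.not_boundedC1Holder tendsto_const_nhds (fun h => hne ?_) hα hρ hball
      rw [hgrad₀.gradient] at h
      exact tendsto_nhds_unique hgrad h
  · intro Ω a β fβ f uβ u x x₀ H _ _ hx hlim α hα ρ hρ hball
    exact H.not_boundedC1Holder hx hlim hα hρ hball
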